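/- **Setting.** Let $n\ge 2$. A strict partition is a sequence $\lambda=(\lambda_1\ge\lambda_2\ge\cdots)$ of non-negative integers with finitely many nonzero parts in which $\lambda_i=\lambda_{i+1}$ only if $\lambda_i=0$; $\ell(\lambda)$ is the number of its nonzero parts, and $D^+_\lambda=\{(i,j): 1\le i\le \ell(\lambda),\ i\le j\le \lambda_i+i-1\}$ is its shifted diagram. Let $\lambda,\mu$ be strict partitions with $D^+_\mu\subseteq D^+_\lambda$ and $\ell(\lambda)\le n$. A tableau of shifted shape $\lambda/\mu$ is a filling $T$ of $D^+_\lambda\setminus D^+_\mu$. Write $T(p,q)$ for the entry in the box $(p,p+q-1)$ (row $p$, $q$-th diagonal), which is empty if the box is not in $D^+_\lambda\setminus D^+_\mu$; write $T^{(k)}$ for the $k$-th row read from left to right, and $w_{\rm rev}(T)=T^{(\ell(\lambda))}\cdots T^{(1)}$ for the reversed reading word. A word $u_1\cdots u_s$ is a *hook word* if $u_1\ge\cdots\ge u_k<u_{k+1}<\cdots<u_s$ for some $1\le k\le s$. Let $\mathbf B_n(\lambda/\mu)$ be the set of tableaux $T$ of shifted shape $\lambda/\mu$ with entries in $[n]=\{1<\cdots<n\}$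 such that every nonempty row $T^{(k)}$ is a hook word and, for $1\le k<\ell(\lambda)$ and $1\le i\le j\le\lambda_{k+1}$, * (S1) if $T(k,i)\le T(k+1,j)$, then $i\ne 1$ and $T(k+1,i-1)<T(k+1,j)$; * (S2) if $T(k,i)>T(k+1,j)$, then $T(k,i)\ge T(k,j+1)$, where an inequality involving an empty entry counts as false. *$\mathfrak q(n)$-crystals.* Let $P=\bigoplus_{k=1}^n\mathbb Z\epsilon_k$, $\langle x,h_i\rangle=x_i-x_{i+1}$ for $x=\sum_k x_k\epsilon_k\in P$, $\alpha_i=\epsilon_i-\epsilon_{i+1}$ and $I=\{1,\dots,n-1,\overline 1\}$. A $\mathfrak q(n)$-crystal is a set $B$ with maps ${\rm wt}:B\to P$, $\varepsilon_i,\varphi_i:B\to\mathbb Z\cup\{-\infty\}$ $(1\le i\le n-1)$ and $\tilde e_i,\tilde f_i:B\to B\cup\{\mathbf 0\}$ $(i\in I)$ such that for all $b,b'\in B$ and $1\le i\le n-1$: $\varphi_i(b)=\langle{\rm wt}(b),h_i\rangle+\varepsilon_i(b)$; if $\tilde e_ib\ne\mathbf 0$, then $\varepsilon_i,\varphi_i,{\rm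 wt}$ change by $-1,+1,+\alpha_i$ under $\tilde e_i$, and if $\tilde f_ib\neq\mathbf 0$, they change by $+1,-1,-\alpha_i$ under $\tilde f_i$; $\tilde f_ib=b'$ if and only if $\tilde e_ib'=b$; $\tilde e_ib=\tilde f_ib=\mathbf 0$ if $\varphi_i(b)=-\infty$; ${\rm wt}(b)\in\bigoplus_k\mathbb Z_{\ge0}\epsilon_k$; $\tilde e_{\overline1}$ and $\tilde f_{\overline1}$, where nonzero, change ${\rm wt}$ by $+\alpha_1$ and $-\alpha_1$; $\tilde f_{\overline1}b=b'$ if and only if $\tilde e_{\overline1}b'=b$; and for $3\le i\le n-1$, $\tilde e_{\overline1},\tilde f_{\overline1}$ commute with $\tilde e_i,\tilde f_i$ (all fixing $\mathbf 0$), and $\varepsilon_i,\varphi_i$ are unchanged by $\tilde e_{\overline 1}$ where it is nonzero. *The maps on words.* Let $\mathcal W_{[n]}$ be the set of finite words in $[n]$. A letter $k$ has weight $\epsilon_k$; on letters $\tilde f_i$ sends $i$ to $i+1$, $\tilde e_i$ sends $i+1$ to $i$, all other values are $\mathbf 0$, $\tilde f_{\overline1}=\tilde f_1$, $\tilde e_{\overline1}=\tilde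 e_1$, $\varphi_i(k)=\delta_{k,i}$ and $\varepsilon_i(k)=\delta_{k,i+1}$. A word $aw$ with first letter $a$ is identified with $a\otimes w$; the empty word has ${\rm wt}=\varepsilon_i=\varphi_i=0$ and $\tilde e_i=\tilde f_i=\mathbf 0$ for all $i \in I$. Here ${\rm wt}(a\otimes w)={\rm wt}(a)+{\rm wt}(w)$ and, for $1\le i\le n-1$, $$\varepsilon_i(a\otimes w)=\max\{\varepsilon_i(a),\varepsilon_i(w)-\langle{\rm wt}(a),h_i\rangle\},\qquad \varphi_i(a\otimes w)=\max\{\varphi_i(a)+\langle{\rm wt}(w),h_i\rangle,\varphi_i(w)\};$$ $\tilde e_i(a\otimes w)$ is $\tilde e_ia\otimes w$ if $\varphi_i(a)\ge\varepsilon_i(w)$ and $a\otimes\tilde e_iw$ otherwise; $\tilde f_i(a\otimes w)$ is $\tilde f_ia\otimes w$ if $\varphi_i(a)>\varepsilon_i(w)$ and $a\otimes\tilde f_iw$ otherwise; and $\tilde e_{\overline1},\tilde f_{\overline1}$ act on $a$ if neither $1$ nor $2$ occurs in $w$, and on $w$ otherwise ($\mathbf 0\otimes w=a\otimes\mathbf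 0=\mathbf 0$). **Proposition.** The map $\mathbf B_n(\lambda/\mu)\to\mathcal W_{[n]}$, $T\mapsto w_{\rm rev}(T)$, is injective, and its image together with $\{\mathbf 0\}$ is invariant under $\tilde e_i$ and $\tilde f_i$ for all $i\in I$. Hence $\mathbf B_n(\lambda/\mu)$ is a $\mathfrak q(n)$-crystal with respect to the maps ${\rm wt},\varepsilon_i,\varphi_i,\tilde e_i,\tilde f_i$ induced from $\mathcal W_{[n]}$ through $w_{\rm rev}$. -/

import Mathlib

/-! # Skew semistandard decomposition tableaux and `q(n)`-crystals

Letters `1, …, n` and the crystal indices `1, …, n - 1` keep their usual names.  Rows of a diagram,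
and the diagonals in it, are numbered from `0`.  The formal symbol `0` of crystal theory is `none`. -/

namespace SkewSSDT

/-! ## Strict partitions and shifted diagrams -/

/-- Strict partitions `(part 0 ≥ part 1 ≥ ⋯)`: equal consecutive parts vanish. -/
structure StrictPartition where
  part : ℕ → ℕ
  part_succ_le : ∀ i, part (i + 1) ≤ part i
  eq_zero_of_eq : ∀ i, part i = part (i + 1) → part i = 0
  finite_support : (Function.support part).Finite

/-- The length: the number of nonzero parts. -/
noncomputable def StrictPartition.length (lam : StrictPartition) : ℕ :=
  (Function.support lam.part).ncard

/-- The shifted diagram: row `p` occupies the columns `p, …, p + part p - 1`. -/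
def StrictPartition.shiftedDiagram (lam : StrictPartition) : Set (ℕ × ℕ) :=
  {x | x.1 ≤ x.2 ∧ x.2 < x.1 + lam.part x.1}

/-! ## Tableaux of shifted skew shape and their words -/

/-- Tableaux of shifted shape `lam / mu` with entries in `A`: arbitrary fillings. -/
abbrev SkewTableau (lam mu : StrictPartition) (A : Type*) : Type _ :=
  ↥(lam.shiftedDiagram \ mu.shiftedDiagram) → A

section Tableau

variable {lam mu : StrictPartition} {A : Type*}

/-- The box in row `p` on the `q`-th diagonal from the main one is `(p, p + q)`. -/
theorem box_mem {p q : ℕ} (h : mu.part p ≤ q ∧ q < lam.part p) :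
    (p, p + q) ∈ lam.shiftedDiagram \ mu.shiftedDiagram := by
  refine ⟨⟨Nat.le_add_right p q, Nat.add_lt_add_left h.2 p⟩, fun hm => ?_⟩
  exact absurd (Nat.lt_of_add_lt_add_left hm.2) (not_lt.mpr h.1)

/-- `T.entry p q`, the entry of `T` in row `p` on the `q`-th diagonal, i.e. in the box `(p, p + q)`;
it is `none` (empty) if this box is not in the skew diagram. -/
def SkewTableau.entry (T : SkewTableau lam mu A) (p q : ℕ) : Option A :=
  if h : mu.part p ≤ q ∧ q < lam.part p then some (T ⟨(p, p + q), box_mem h⟩) else none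

/-- The word of row `p`, read from left to right. -/
def SkewTableau.row (T : SkewTableau lam mu A) (p : ℕ) : List A :=
  (List.range (lam.part p)).filterMap (SkewTableau.entry T p)

/-- The reading word: rows from top to bottom, each row from right to left. -/
noncomputable def SkewTableau.word (T : SkewTableau lam mu A) : List A :=
  (List.range lam.length).flatMap fun p => (SkewTableau.row T p).reverse

/-- The reversed reading word. -/
noncomputable def SkewTableau.revWord (T : SkewTableau lam mu A) : List A :=
  (SkewTableau.word T).reverse

variable [LinearOrder A]

/-- Hook words `u₁ ≥ ⋯ ≥ u_k < u_{k+1} < ⋯ < u_s` with `1 ≤ k ≤ s`; here `u_k` is `x`. -/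
def IsHookWord (u : List A) : Prop :=
  ∃ (d : List A) (x : A) (r : List A), u = d ++ x :: r ∧
    (d ++ [x]).Pairwise (fun a b => a ≥ b) ∧ (x :: r).Pairwise (fun a b => a < b)

/-- Skew semistandard decomposition tableaux.  Each (nonempty) row is a hook word, and the entries
satisfy the two conditions relating consecutive rows; an inequality with an empty entry counts as
false.  (For `j < lam.part (k + 1)`, row `k + 1` is automatically one of the rows of `lam`.) -/
structure SkewTableau.IsSkewSSDT (T : SkewTableau lam mu A) : Prop where
  hook : ∀ k, SkewTableau.row T k ≠ [] → IsHookWord (SkewTableau.row T k)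
  /-- If `T(k, i) ≤ T(k + 1, j)`, then `i` is not the main diagonal and
  `T(k + 1, i - 1) < T(k + 1, j)`. -/
  cond_one : ∀ k i j, i ≤ j → j < lam.part (k + 1) →
    ∀ a ∈ SkewTableau.entry T k i, ∀ b ∈ SkewTableau.entry T (k + 1) j, a ≤ b →
      i ≠ 0 ∧ ∃ c ∈ SkewTableau.entry T (k + 1) (i - 1), c < b
  /-- If `T(k, i) > T(k + 1, j)`, then `T(k, i) ≥ T(k, j + 1)`. -/
  cond_two : ∀ k i j, i ≤ j → j < lam.part (k + 1) →
    ∀ a ∈ SkewTableau.entry T k i, ∀ b ∈ SkewTableau.entry T (k + 1) j, a > b →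
      ∃ c ∈ SkewTableau.entry T k (j + 1), a ≥ c

end Tableau

/-! ## Weights, indices and `q(n)`-crystals -/

/-- The alphabet `[n] = {1 < 2 < ⋯ < n}`. -/
abbrev Letter (n : ℕ) : Type := {k : ℕ // 1 ≤ k ∧ k ≤ n}

/-- The set `B_n(lam / mu)` of skew semistandard decomposition tableaux with entries in `[n]`. -/
def skewB (n : ℕ) (lam mu : StrictPartition) : Set (SkewTableau lam mu (Letter n)) :=
  {T | SkewTableau.IsSkewSSDT T}

/-- The weight lattice `⊕ ℤ ε_k` (`1 ≤ k ≤ n`). -/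
abbrev Weight (n : ℕ) : Type := Letter n → ℤ

/-- The coefficient of `ε_i` in a weight (`0` if `i` is not in `[n]`). -/
def Weight.coeff {n : ℕ} (x : Weight n) (i : ℕ) : ℤ :=
  if h : 1 ≤ i ∧ i ≤ n then x ⟨i, h⟩ else 0

/-- The pairing `⟨x, h_i⟩` with the simple coroot `h_i = e_i - e_{i+1}`. -/
def Weight.pairing {n : ℕ} (x : Weight n) (i : ℕ) : ℤ :=
  Weight.coeff x i - Weight.coeff x (i + 1)

/-- The fundamental weight vector `ε_i`. -/
def eps (n i : ℕ) : Weight n := fun k => if k.1 = i then 1 else 0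

/-- The simple root `α_i = ε_i - ε_{i+1}`. -/
def simpleRoot (n i : ℕ) : Weight n := eps n i - eps n (i + 1)

/-- The `gl(n)` part `{1, …, n - 1}` of the index set. -/
abbrev GlIndex (n : ℕ) : Type := {i : ℕ // 1 ≤ i ∧ i < n}

/-- The index set `I = {1, …, n - 1, 1̄}`. -/
inductive QIndex (n : ℕ) : Type
  | gl (i : GlIndex n) : QIndex n
  | bar : QIndex n

/-- The maps of a crystal; `none` in the values of `e` and `f` is the formal symbol `0`. -/
structure CrystalData (n : ℕ) (B : Type*) where
  wt : B → Weight n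
  ε : GlIndex n → B → WithBot ℤ
  φ : GlIndex n → B → WithBot ℤ
  e : QIndex n → B → Option B
  f : QIndex n → B → Option B

/-- The axioms of a `gl(n)`-crystal. -/
structure CrystalData.IsGlCrystal {n : ℕ} {B : Type*} (C : CrystalData n B) : Prop where
  phi_eq : ∀ (i : GlIndex n) (b : B),
    C.φ i b = ((Weight.pairing (C.wt b) i.1 : ℤ) : WithBot ℤ) + C.ε i b
  e_spec : ∀ (i : GlIndex n) (b b' : B), C.e (.gl i) b = some b' →
    C.ε i b' = C.ε i b + ((-1 : ℤ) : WithBot ℤ) ∧ C.φ i b' = C.φ i b + ((1 : ℤ) : WithBot ℤ) ∧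
      C.wt b' = C.wt b + simpleRoot n i.1
  f_spec : ∀ (i : GlIndex n) (b b' : B), C.f (.gl i) b = some b' →
    C.ε i b' = C.ε i b + ((1 : ℤ) : WithBot ℤ) ∧ C.φ i b' = C.φ i b + ((-1 : ℤ) : WithBot ℤ) ∧
      C.wt b' = C.wt b - simpleRoot n i.1
  f_iff_e : ∀ (i : GlIndex n) (b b' : B), C.f (.gl i) b = some b' ↔ C.e (.gl i) b' = some b
  eq_none_of_bot : ∀ (i : GlIndex n) (b : B), C.φ i b = ⊥ →
    C.e (.gl i) b = none ∧ C.f (.gl i) b = none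

/-- The axioms of a `q(n)`-crystal.  Commutation is that of maps `B ∪ {0} → B ∪ {0}` fixing `0`. -/
structure CrystalData.IsQCrystal {n : ℕ} {B : Type*} (C : CrystalData n B) : Prop
    extends C.IsGlCrystal where
  wt_nonneg : ∀ (b : B) (k : Letter n), 0 ≤ C.wt b k
  wt_e_bar : ∀ b b' : B, C.e .bar b = some b' → C.wt b' = C.wt b + simpleRoot n 1
  wt_f_bar : ∀ b b' : B, C.f .bar b = some b' → C.wt b' = C.wt b - simpleRoot n 1
  f_bar_iff_e_bar : ∀ b b' : B, C.f .bar b = some b' ↔ C.e .bar b' = some b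
  e_bar_comm_e : ∀ i : GlIndex n, 3 ≤ i.1 → ∀ b : B,
    (C.e (.gl i) b).bind (C.e .bar) = (C.e .bar b).bind (C.e (.gl i))
  e_bar_comm_f : ∀ i : GlIndex n, 3 ≤ i.1 → ∀ b : B,
    (C.f (.gl i) b).bind (C.e .bar) = (C.e .bar b).bind (C.f (.gl i))
  f_bar_comm_e : ∀ i : GlIndex n, 3 ≤ i.1 → ∀ b : B,
    (C.e (.gl i) b).bind (C.f .bar) = (C.f .bar b).bind (C.e (.gl i))
  f_bar_comm_f : ∀ i : GlIndex n, 3 ≤ i.1 → ∀ b : B,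
    (C.f (.gl i) b).bind (C.f .bar) = (C.f .bar b).bind (C.f (.gl i))
  e_bar_string : ∀ i : GlIndex n, 3 ≤ i.1 → ∀ b b' : B, C.e .bar b = some b' →
    C.ε i b' = C.ε i b ∧ C.φ i b' = C.φ i b

/-! ## The crystal of words

A word `a :: w` is the tensor product `a ⊗ w`, and the empty word spans the trivial crystal. -/

/-- On letters, `e_i` sends `i + 1` to `i` and everything else to `0`
(`e_1̄` is the case `i = 1`). -/
def letterE {n : ℕ} (i : ℕ) (a : Letter n) : Option (Letter n) :=
  if h : 1 ≤ i ∧ a.1 = i + 1 then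
    some ⟨i, h.1, by have := a.2.2; omega⟩ else none

/-- On letters, `f_i` sends `i` to `i + 1` and everything else to `0`
(`f_1̄` is the case `i = 1`). -/
def letterF {n : ℕ} (i : ℕ) (a : Letter n) : Option (Letter n) :=
  if h : a.1 = i ∧ i + 1 ≤ n then some ⟨i + 1, Nat.le_add_left 1 i, h.2⟩ else none

/-- `ε_i` of a letter. -/
def letterEps {n : ℕ} (i : ℕ) (a : Letter n) : ℤ := if a.1 = i + 1 then 1 else 0

/-- `φ_i` of a letter. -/
def letterPhi {n : ℕ} (i : ℕ) (a : Letter n) : ℤ := if a.1 = i then 1 else 0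

/-- `wt(a ⊗ w) = wt(a) + wt(w)`. -/
def wordWt {n : ℕ} : List (Letter n) → Weight n
  | [] => 0
  | a :: w => eps n a.1 + wordWt w

/-- `ε_i(a ⊗ w) = max {ε_i(a), ε_i(w) - ⟨wt(a), h_i⟩}`. -/
def wordEps {n : ℕ} (i : ℕ) : List (Letter n) → ℤ
  | [] => 0
  | a :: w => max (letterEps i a) (wordEps i w - Weight.pairing (eps n a.1) i)

/-- `φ_i(a ⊗ w) = max {φ_i(a) + ⟨wt(w), h_i⟩, φ_i(w)}`. -/
def wordPhi {n : ℕ} (i : ℕ) : List (Letter n) → ℤ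
  | [] => 0
  | a :: w => max (letterPhi i a + Weight.pairing (wordWt w) i) (wordPhi i w)

/-- `e_i(a ⊗ w)` is `e_i a ⊗ w` if `φ_i(a) ≥ ε_i(w)`, and `a ⊗ e_i w` otherwise. -/
def wordE {n : ℕ} (i : ℕ) : List (Letter n) → Option (List (Letter n))
  | [] => none
  | a :: w =>
    if letterPhi i a ≥ wordEps i w then (letterE i a).map (fun a' => a' :: w)
    else (wordE i w).map (fun w' => a :: w')

/-- `f_i(a ⊗ w)` is `f_i a ⊗ w` if `φ_i(a) > ε_i(w)`, and `a ⊗ f_i w` otherwise. -/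
def wordF {n : ℕ} (i : ℕ) : List (Letter n) → Option (List (Letter n))
  | [] => none
  | a :: w =>
    if letterPhi i a > wordEps i w then (letterF i a).map (fun a' => a' :: w)
    else (wordF i w).map (fun w' => a :: w')

/-- `e_1̄(a ⊗ w)` is `e_1̄ a ⊗ w` if `ε_1`, `ε_2` do not occur in `wt(w)`, and `a ⊗ e_1̄ w`
otherwise. -/
def wordEBar {n : ℕ} : List (Letter n) → Option (List (Letter n))
  | [] => none
  | a :: w =>
    if Weight.coeff (wordWt w) 1 = 0 ∧ Weight.coeff (wordWt w) 2 = 0 then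
      (letterE 1 a).map (fun a' => a' :: w)
    else (wordEBar w).map (fun w' => a :: w')

/-- `f_1̄(a ⊗ w)` is `f_1̄ a ⊗ w` if `ε_1`, `ε_2` do not occur in `wt(w)`, and `a ⊗ f_1̄ w`
otherwise. -/
def wordFBar {n : ℕ} : List (Letter n) → Option (List (Letter n))
  | [] => none
  | a :: w =>
    if Weight.coeff (wordWt w) 1 = 0 ∧ Weight.coeff (wordWt w) 2 = 0 then
      (letterF 1 a).map (fun a' => a' :: w)
    else (wordFBar w).map (fun w' => a :: w')

/-- The `q(n)`-crystal maps on the set of words with letters in `[n]`. -/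
def wordCrystal (n : ℕ) : CrystalData n (List (Letter n)) where
  wt := wordWt
  ε i w := ((wordEps i.1 w : ℤ) : WithBot ℤ)
  φ i w := ((wordPhi i.1 w : ℤ) : WithBot ℤ)
  e
    | .gl i => wordE i.1
    | .bar => wordEBar
  f
    | .gl i => wordF i.1
    | .bar => wordFBar

end SkewSSDT

open SkewSSDT

/-! Write `L w` for the greatest length of a hook subword of a word `w`.  After padding the boxes of
`mu` with large letters, row `k` of a tableau is a hook word iff `L` of it is at least its length
`lam.part k`.  For hook rows, (S1) and (S2) together say that `L (row (k + 1) ++ row k)` is at most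
`lam.part k`: a violation of (S1) or (S2) yields a hook subword of the two consecutive rows that is
longer than the upper row, and conversely.

The operators change one letter `x` of the reading word to `x + 1` or back, where the signature rule
(for index `1̄`, the absence of `1` and `2` to the right) restricts the words on both sides of this
letter.  For index `i < n`, such a change preserves the greatest lengths of weakly decreasing and of
strictly increasing subwords of all factors of the word, hence `L`; for index `1̄`, it preserves `L`
directly.  So the tableau conditions are preserved, and the axioms of a `q(n)`-crystal pass from
words to tableaux along the injective reading map. -/

namespace SkewSSDT

/-! ### Hook words -/

section Hooks

variable {α : Type*} [LinearOrder α]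

/-- Words without a subword `a < b ≥ c`: the hook words, and the empty word. -/
def IsHook (w : List α) : Prop := w.Triplewise fun a b c => a < b → b < c

theorem IsHook.sublist {v w : List α} (hw : IsHook w) (h : v.Sublist w) : IsHook v := by
  unfold IsHook at *
  induction h with
  | slnil => exact hw
  | cons a _ ih => exact ih (List.triplewise_cons.1 hw).2
  | cons_cons a h ih =>
    rw [List.triplewise_cons] at hw ⊢
    exact ⟨hw.1.sublist h, ih hw.2⟩

theorem IsHook.lt_of_sublist {w : List α} (hw : IsHook w) {a b c : α}
    (h : [a, b, c].Sublist w) (hab : a < b) : b < c :=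
  List.triplewise_triple.1 (hw.sublist h) hab

theorem isHook_of_pairwise_ge {d : List α} (hd : d.Pairwise (· ≥ ·)) : IsHook d := by
  induction hd with
  | nil => exact .nil
  | cons ha hd ih =>
    exact .cons (hd.imp_of_mem fun hb _ _ hab => absurd hab (ha _ hb).not_gt) ih

theorem isHook_of_pairwise_lt {r : List α} (hr : r.Pairwise (· < ·)) : IsHook r := by
  induction hr with
  | nil => exact .nil
  | cons _ hr ih => exact .cons (hr.imp (Function.const _)) ih

theorem isHook_append {d r : List α} (hd : d.Pairwise (· ≥ ·)) (hr : r.Pairwise (· < ·)) :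
    IsHook (d ++ r) :=
  List.triplewise_append.2 ⟨isHook_of_pairwise_ge hd, isHook_of_pairwise_lt hr,
    fun _ _ => hr.imp (Function.const _), fun _ _ => hd.imp fun hba hab => absurd hab hba.not_gt⟩

theorem IsHook.append_left {d w : List α} {b : α} (hw : IsHook (b :: w))
    (hd : d.Pairwise (· ≥ ·)) (hb : ∀ a ∈ d, b ≤ a) : IsHook (d ++ b :: w) :=
  List.triplewise_append.2 ⟨isHook_of_pairwise_ge hd, hw,
    fun a ha => List.pairwise_cons.2 ⟨fun _ _ hab => absurd hab (hb a ha).not_gt,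
      (List.triplewise_cons.1 hw).1.imp fun h hac => h ((hb a ha).trans_lt hac)⟩,
    fun _ _ => hd.imp fun hba hab => absurd hab hba.not_gt⟩

theorem IsHook.append_right {w r : List α} {x : α} (hw : IsHook (w ++ [x]))
    (hr : (x :: r).Pairwise (· < ·)) : IsHook (w ++ x :: r) := by
  obtain ⟨hw, -, -, hx⟩ := List.triplewise_append.1 hw
  refine List.triplewise_append.2 ⟨hw, isHook_of_pairwise_lt hr,
    fun _ _ => hr.imp (Function.const _), fun c hc => (hx x (by simp)).imp fun h hab => ?_⟩
  obtain rfl | hc := List.mem_cons.1 hc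
  · exact h hab
  · exact (h hab).trans (List.rel_of_pairwise_cons hr hc)

theorem IsHook.pairwise_lt {a b : α} {w : List α} (hw : IsHook (a :: b :: w)) (hab : a < b) :
    (a :: b :: w).Pairwise (· < ·) := by
  obtain ⟨hb, hlt⟩ := List.pairwise_cons.1 (List.triplewise_cons.1 hw).1
  have ha : ∀ c ∈ w, a < c := fun c hc => hab.trans (hb c hc hab)
  simp only [List.pairwise_cons, List.forall_mem_cons]
  exact ⟨⟨hab, ha⟩, fun c hc => hb c hc hab, hlt.imp_of_mem fun hc _ h => h (ha _ hc)⟩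

theorem IsHook.pairwise_ge {w : List α} {a b : α} (hw : IsHook (w ++ [b, a])) (hab : a ≤ b) :
    (w ++ [b, a]).Pairwise (· ≥ ·) := by
  obtain ⟨-, -, hba, hlt⟩ := List.triplewise_append.1 hw
  have hb : ∀ c ∈ w, b ≤ c := fun c hc =>
    not_lt.1 fun h => (List.pairwise_pair.1 (hba c hc) h).not_ge hab
  refine List.pairwise_append.2 ⟨(hlt b (by simp)).imp_of_mem fun _ hd h =>
    not_lt.1 fun hcd => (h hcd).not_ge (hb _ hd), List.pairwise_pair.2 hab, fun c hc => ?_⟩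
  simpa using ⟨hb c hc, hab.trans (hb c hc)⟩

theorem isHookWord_iff {w : List α} : IsHookWord w ↔ w ≠ [] ∧ IsHook w := by
  constructor
  · rintro ⟨d, x, r, rfl, hd, hr⟩
    exact ⟨by simp, isHook_append (List.pairwise_append.1 hd).1 hr⟩
  · rintro ⟨hne, hw⟩
    induction w with
    | nil => exact absurd rfl hne
    | cons a w ih =>
      rcases w with - | ⟨b, w⟩
      · exact ⟨[], a, [], by simp⟩
      rcases lt_or_ge a b with hab | hba
      · exact ⟨[], a, b :: w, by simp, by simp, hw.pairwise_lt hab⟩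
      · obtain ⟨d, x, r, heq, hd, hr⟩ := ih (by simp) (hw.sublist (List.sublist_cons_self _ _))
        refine ⟨a :: d, x, r, by rw [heq, List.cons_append], ?_, hr⟩
        rw [List.cons_append, List.pairwise_cons]
        refine ⟨fun c hc => le_trans ?_ hba, hd⟩
        rcases d with - | ⟨b', d⟩ <;> obtain ⟨rfl, -⟩ := List.cons.inj heq
        · exact (List.mem_singleton.1 hc).le
        · exact (List.mem_cons.1 hc).elim le_of_eq (List.rel_of_pairwise_cons hd)

theorem IsHook.exists_eq_append {w : List α} (hw : IsHook w) :
    ∃ d r, w = d ++ r ∧ d.Pairwise (· ≥ ·) ∧ r.Pairwise (· < ·) := by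
  rcases eq_or_ne w [] with rfl | hne
  · exact ⟨[], [], by simp⟩
  · obtain ⟨d, x, r, h, hd, hr⟩ := isHookWord_iff.2 ⟨hne, hw⟩
    exact ⟨d, x :: r, h, (List.pairwise_append.1 hd).1, hr⟩

end Hooks

/-! ### Hook lengths -/

section MaxLength

variable {α : Type*}

/-- The greatest length of a subword of `w` with the property `P`
(and `0` if there is no such subword). -/
noncomputable def maxLength (P : List α → Prop) (w : List α) : ℕ :=
  sSup (List.length '' {s | s.Sublist w ∧ P s})

theorem bddAbove_length_sublist (P : List α → Prop) (w : List α) :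
    BddAbove (List.length '' {s | s.Sublist w ∧ P s}) :=
  ⟨w.length, Set.forall_mem_image.2 fun _ hs => hs.1.length_le⟩

theorem maxLength_le_iff {P : List α → Prop} {w : List α} {m : ℕ} :
    maxLength P w ≤ m ↔ ∀ s, s.Sublist w → P s → s.length ≤ m := by
  simp only [maxLength, csSup_le_iff' (bddAbove_length_sublist P w), Set.forall_mem_image,
    Set.mem_ofPred_eq, and_imp]

theorem length_le_maxLength {P : List α → Prop} {s w : List α} (hs : s.Sublist w) (hP : P s) :
    s.length ≤ maxLength P w :=
  maxLength_le_iff.1 le_rfl s hs hP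

theorem exists_length_eq_maxLength {P : List α → Prop} (hP : P []) (w : List α) :
    ∃ s, s.Sublist w ∧ P s ∧ s.length = maxLength P w := by
  have hne : {s | s.Sublist w ∧ P s}.Nonempty := ⟨[], List.nil_sublist w, hP⟩
  obtain ⟨s, ⟨hs, hPs⟩, hlen⟩ := Nat.sSup_mem (hne.image _) (bddAbove_length_sublist P w)
  exact ⟨s, hs, hPs, hlen⟩

theorem maxLength_pairwise_le_reverse (R : α → α → Prop) (w : List α) :
    maxLength (List.Pairwise R) w ≤ maxLength (List.Pairwise (flip R)) w.reverse :=
  maxLength_le_iff.2 fun s hs hR => s.length_reverse ▸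
    length_le_maxLength (List.reverse_sublist.2 hs) (List.pairwise_reverse.2 hR)

theorem maxLength_pairwise_reverse (R : α → α → Prop) (w : List α) :
    maxLength (List.Pairwise (flip R)) w.reverse = maxLength (List.Pairwise R) w :=
  (by simpa using! maxLength_pairwise_le_reverse (flip R) w.reverse : _ ≤ _).antisymm
    (maxLength_pairwise_le_reverse R w)

variable [LinearOrder α]

/-- The greatest length of a hook subword of `w`. -/
noncomputable def hookLength (w : List α) : ℕ := maxLength IsHook w

theorem length_le_hookLength_iff {w : List α} : w.length ≤ hookLength w ↔ IsHook w := by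
  refine ⟨fun h => ?_, fun hw => length_le_maxLength (List.Sublist.refl w) hw⟩
  obtain ⟨s, hs, hhook, hlen⟩ := exists_length_eq_maxLength (P := IsHook) .nil w
  rwa [hs.eq_of_length_le (hlen ▸ h)] at hhook

theorem hookLength_nil : hookLength ([] : List α) = 0 :=
  Nat.le_zero.1 (maxLength_le_iff.2 fun _ hs _ => hs.length_le)

theorem hookLength_le_iff {w : List α} {m : ℕ} : hookLength w ≤ m ↔ ∀ w₁ w₂, w₁ ++ w₂ = w →
    maxLength (List.Pairwise (· ≥ ·)) w₁ + maxLength (List.Pairwise (· < ·)) w₂ ≤ m := by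
  rw [hookLength, maxLength_le_iff]
  constructor
  · rintro h w₁ w₂ rfl
    obtain ⟨d, hdw, hd, hdlen⟩ := exists_length_eq_maxLength (P := List.Pairwise (· ≥ ·)) .nil w₁
    obtain ⟨r, hrw, hr, hrlen⟩ := exists_length_eq_maxLength (P := List.Pairwise (· < ·)) .nil w₂
    rw [← hdlen, ← hrlen, ← List.length_append]
    exact h _ (hdw.append hrw) (isHook_append hd hr)
  · intro h s hs hhook
    obtain ⟨d, r, rfl, hd, hr⟩ := hhook.exists_eq_append
    obtain ⟨w₁, w₂, rfl, hdw, hrw⟩ := List.append_sublist_iff.1 hs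
    rw [List.length_append]
    exact (add_le_add (length_le_maxLength hdw hd) (length_le_maxLength hrw hr)).trans (h _ _ rfl)

end MaxLength

section Balanced

variable {α : Type*} [DecidableEq α]

/-- The signature rule for the letters `p < q`: after bracketing each `p` with a later `q`, only
letters `q` remain in `A` and only letters `p` remain in `B`, so that the crystal operators change
a letter between `A` and `B`. -/
def Balanced (p q : α) (A B : List α) : Prop :=
  (∀ S, S <:+ A → S.count p ≤ S.count q) ∧ ∀ S, S <+: B → S.count q ≤ S.count p

theorem Balanced.of_append_left {p q : α} {A₀ A B : List α} (h : Balanced p q (A₀ ++ A) B) :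
    Balanced p q A B :=
  ⟨fun S hS => h.1 S (hS.trans (List.suffix_append A₀ A)), h.2⟩

theorem Balanced.of_append_right {p q : α} {A B B₀ : List α} (h : Balanced p q A (B ++ B₀)) :
    Balanced p q A B :=
  ⟨h.1, fun S hS => h.2 S (hS.trans (List.prefix_append B B₀))⟩

theorem Balanced.reverse {p q : α} {A B : List α} (h : Balanced p q A B) :
    Balanced q p B.reverse A.reverse :=
  ⟨fun S hS => by simpa using h.2 S.reverse (by simpa [← List.reverse_prefix] using hS),
    fun S hS => by simpa using h.1 S.reverse (by simpa [← List.reverse_suffix] using hS)⟩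

theorem Balanced.cons_sublist {p q : α} {A B t : List α} (h : Balanced p q A B)
    (hpq : p ≠ q) (ht : (q :: t).Sublist B) : (p :: q :: t).Sublist B := by
  obtain ⟨B₁, B₂, rfl, hq, htB⟩ := List.cons_sublist_iff.1 ht
  obtain ⟨C, D, rfl⟩ := List.append_of_mem hq
  have hcount := h.2 (C ++ [q]) ⟨D ++ B₂, by simp⟩
  have hp : p ∈ C ++ [q] := List.count_pos_iff.1 (lt_of_lt_of_le (by simp) hcount)
  have hpC : p ∈ C := by simpa [hpq] using hp
  simpa using (List.singleton_sublist.2 hpC).append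
    ((htB.trans (List.sublist_append_right D B₂)).cons_cons q)

end Balanced

section Exchange

variable {α : Type*}

theorem sublist_append_cons_iff {s A B : List α} {x : α} :
    s.Sublist (A ++ x :: B) ↔ s.Sublist (A ++ B) ∨
      ∃ s₁ s₂, s = s₁ ++ x :: s₂ ∧ s₁.Sublist A ∧ s₂.Sublist B := by
  constructor
  · rw [List.sublist_append_iff]
    rintro ⟨s₁, s₂, rfl, h₁, h₂⟩
    rcases h₂ with - | ⟨-, h₂⟩ | ⟨-, h₂⟩
    · exact .inl (h₁.append h₂)
    · exact .inr ⟨s₁, _, rfl, h₁, h₂⟩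
  · rintro (h | ⟨s₁, s₂, rfl, h₁, h₂⟩)
    · exact h.trans ((List.sublist_cons_self x B).append_left A)
    · exact h₁.append (h₂.cons_cons x)

theorem append_eq_append_cons_iff {W₁ W₂ A B : List α} {x : α} :
    W₁ ++ W₂ = A ++ x :: B ↔
      (∃ C, W₁ = A ++ x :: C ∧ B = C ++ W₂) ∨ ∃ C, A = W₁ ++ C ∧ W₂ = C ++ x :: B := by
  rw [List.append_eq_append_iff]
  constructor
  · rintro (⟨C, rfl, rfl⟩ | ⟨C, rfl, hC⟩)
    · exact .inr ⟨C, rfl, rfl⟩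
    · rcases C with - | ⟨y, C⟩
      · exact .inr ⟨[], by simpa using hC.symm⟩
      · obtain ⟨rfl, rfl⟩ := List.cons.inj hC
        exact .inl ⟨C, rfl, rfl⟩
  · rintro (⟨C, rfl, rfl⟩ | ⟨C, rfl, rfl⟩)
    · exact .inr ⟨x :: C, rfl, rfl⟩
    · exact .inl ⟨C, rfl, rfl⟩

variable [LinearOrder α]

theorem exists_eq_append_replicate {p : α} {s : List α} (hs : s.Pairwise (· ≥ ·))
    (hp : ∀ a ∈ s, p ≤ a) : ∃ t k, s = t ++ List.replicate k p ∧ ∀ a ∈ t, p < a := by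
  induction s with
  | nil => exact ⟨[], 0, by simp⟩
  | cons a s ih =>
    obtain ⟨ha, hs⟩ := List.pairwise_cons.1 hs
    rw [List.forall_mem_cons] at hp
    rcases hp.1.eq_or_lt with rfl | hlt
    · exact ⟨[], s.length + 1, List.eq_replicate_iff.2 ⟨rfl, by grind⟩, by simp⟩
    · obtain ⟨t, k, rfl, ht⟩ := ih hs hp.2
      exact ⟨a :: t, k, rfl, List.forall_mem_cons.2 ⟨hlt, ht⟩⟩

theorem Balanced.maxLength_ge_le {p q : α} {A B : List α} (h : Balanced p q A B) (hpq : p ⋖ q) :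
    maxLength (List.Pairwise (· ≥ ·)) (A ++ p :: B) ≤
      maxLength (List.Pairwise (· ≥ ·)) (A ++ q :: B) := by
  refine maxLength_le_iff.2 fun s hs hdec => ?_
  obtain hs | ⟨s₁, s₂, rfl, hs₁, hs₂⟩ := sublist_append_cons_iff.1 hs
  · exact length_le_maxLength (sublist_append_cons_iff.2 (.inl hs)) hdec
  obtain ⟨hdec₁, hdec₂, hdec₁₂⟩ := List.pairwise_append.1 hdec
  obtain ⟨t, k, rfl, ht⟩ := exists_eq_append_replicate hdec₁ fun a ha => hdec₁₂ a ha p (by simp)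
  obtain ⟨A₁, A₂, rfl, hA₁, hA₂⟩ := List.append_sublist_iff.1 hs₁
  -- The final letters `p` of `s₁` lie in a suffix of `A`, which has at least as many letters `q`.
  have hk : (List.replicate k q).Sublist A₂ := List.replicate_sublist_iff.2
    ((List.replicate_sublist_iff.1 hA₂).trans (h.1 A₂ (List.suffix_append A₁ A₂)))
  have hsub : (t ++ List.replicate k q ++ q :: s₂).Sublist (A₁ ++ A₂ ++ q :: B) :=
    (hA₁.append hk).append (hs₂.cons_cons q)
  have ht' : ∀ a ∈ t, q ≤ a := fun a ha => hpq.ge_of_gt (ht a ha)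
  have hs₂q : ∀ a ∈ s₂, a ≤ q := fun a ha => (List.rel_of_pairwise_cons hdec₂ ha).trans hpq.le
  refine (Eq.le (by simp)).trans (length_le_maxLength hsub ?_)
  refine List.pairwise_append.2 ⟨List.pairwise_append.2 ⟨(List.pairwise_append.1 hdec₁).1,
    List.pairwise_replicate.2 (.inr le_rfl),
      fun a ha b hb => List.eq_of_mem_replicate hb ▸ ht' a ha⟩,
    List.pairwise_cons.2 ⟨hs₂q, hdec₂.of_cons⟩, fun a ha b hb => ?_⟩
  have hqa : q ≤ a :=
    (List.mem_append.1 ha).elim (ht' a) fun ha => (List.eq_of_mem_replicate ha).ge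
  exact (List.mem_cons.1 hb).elim (fun hb => hb.trans_le hqa) fun hb => (hs₂q b hb).trans hqa

theorem Balanced.maxLength_lt_le {p q : α} {A B : List α} (h : Balanced p q A B) (hpq : p ⋖ q) :
    maxLength (List.Pairwise (· < ·)) (A ++ p :: B) ≤
      maxLength (List.Pairwise (· < ·)) (A ++ q :: B) := by
  refine maxLength_le_iff.2 fun s hs hinc => ?_
  obtain hs | ⟨s₁, s₂, rfl, hs₁, hs₂⟩ := sublist_append_cons_iff.1 hs
  · exact length_le_maxLength (sublist_append_cons_iff.2 (.inl hs)) hinc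
  obtain ⟨hinc₁, hinc₂, hinc₁₂⟩ := List.pairwise_append.1 hinc
  by_cases hq : q ∈ s₂
  · obtain ⟨c, t, rfl⟩ := List.append_of_mem hq
    have hc : c = [] := List.eq_nil_iff_forall_not_mem.2 fun b hb =>
      hpq.2 (List.rel_of_pairwise_cons hinc₂ (by simp [hb]))
        ((List.pairwise_append.1 hinc₂.of_cons).2.2 b hb q (by simp))
    subst hc
    -- By balance, `p` occurs in `B` before the letter `q`, so it can replace the middle one.
    exact length_le_maxLength
      (sublist_append_cons_iff.2 (.inl (hs₁.append (h.cons_sublist hpq.ne hs₂)))) hinc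
  · have hq₂ : ∀ b ∈ s₂, q < b := fun b hb =>
      (hpq.ge_of_gt (List.rel_of_pairwise_cons hinc₂ hb)).lt_of_ne fun h => hq (h ▸ hb)
    have hs₁q : ∀ a ∈ s₁, a < q := fun a ha => (hinc₁₂ a ha p (by simp)).trans hpq.lt
    refine (Eq.le (by simp)).trans (length_le_maxLength
      (sublist_append_cons_iff.2 (.inr ⟨s₁, s₂, rfl, hs₁, hs₂⟩)) ?_)
    exact List.pairwise_append.2 ⟨hinc₁, List.pairwise_cons.2 ⟨hq₂, hinc₂.of_cons⟩,
      fun a ha b hb => (List.mem_cons.1 hb).elim (fun hb => hb ▸ hs₁q a ha)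
        fun hb => (hs₁q a ha).trans (hq₂ b hb)⟩

theorem Balanced.maxLength_ge {p q : α} {A B : List α} (h : Balanced p q A B) (hpq : p ⋖ q) :
    maxLength (List.Pairwise (· ≥ ·)) (A ++ p :: B) =
      maxLength (List.Pairwise (· ≥ ·)) (A ++ q :: B) := by
  refine (h.maxLength_ge_le hpq).antisymm ?_
  have hdual := Balanced.maxLength_ge_le (α := αᵒᵈ) h.reverse hpq.toDual
  rw [← maxLength_pairwise_reverse _ (A ++ q :: B), ← maxLength_pairwise_reverse _ (A ++ p :: B)]
  simp only [List.reverse_append, List.reverse_cons, List.append_assoc, List.singleton_append]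
  exact hdual

theorem Balanced.maxLength_lt {p q : α} {A B : List α} (h : Balanced p q A B) (hpq : p ⋖ q) :
    maxLength (List.Pairwise (· < ·)) (A ++ p :: B) =
      maxLength (List.Pairwise (· < ·)) (A ++ q :: B) := by
  refine (h.maxLength_lt_le hpq).antisymm ?_
  have hdual := Balanced.maxLength_lt_le (α := αᵒᵈ) h.reverse hpq.toDual
  rw [← maxLength_pairwise_reverse _ (A ++ q :: B), ← maxLength_pairwise_reverse _ (A ++ p :: B)]
  simp only [List.reverse_append, List.reverse_cons, List.append_assoc, List.singleton_append]
  exact hdual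

theorem hookLength_append_cons_le_iff {A B : List α} {x : α} {m : ℕ} :
    hookLength (A ++ x :: B) ≤ m ↔
      (∀ C W, C ++ W = B → maxLength (List.Pairwise (· ≥ ·)) (A ++ x :: C) +
        maxLength (List.Pairwise (· < ·)) W ≤ m) ∧
      ∀ W C, W ++ C = A → maxLength (List.Pairwise (· ≥ ·)) W +
        maxLength (List.Pairwise (· < ·)) (C ++ x :: B) ≤ m := by
  rw [hookLength_le_iff]
  constructor
  · refine fun h => ⟨?_, ?_⟩ <;> rintro C W rfl <;> exact h _ _ (by simp)
  · rintro ⟨hB, hA⟩ W₁ W₂ h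
    obtain ⟨C, rfl, rfl⟩ | ⟨C, rfl, rfl⟩ := append_eq_append_cons_iff.1 h
    · exact hB C W₂ rfl
    · exact hA W₁ C rfl

theorem Balanced.hookLength_eq {p q : α} {A B : List α} (h : Balanced p q A B) (hpq : p ⋖ q) :
    hookLength (A ++ p :: B) = hookLength (A ++ q :: B) := by
  have hdec : ∀ C W, C ++ W = B → maxLength (List.Pairwise (· ≥ ·)) (A ++ p :: C) =
      maxLength (List.Pairwise (· ≥ ·)) (A ++ q :: C) := by
    rintro C W rfl
    exact h.of_append_right.maxLength_ge hpq
  have hinc : ∀ W C, W ++ C = A → maxLength (List.Pairwise (· < ·)) (C ++ p :: B) =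
      maxLength (List.Pairwise (· < ·)) (C ++ q :: B) := by
    rintro W C rfl
    exact h.of_append_left.maxLength_lt hpq
  refine eq_of_forall_ge_iff fun m => ?_
  rw [hookLength_append_cons_le_iff, hookLength_append_cons_le_iff]
  exact and_congr (forall₃_congr fun C W hCW => by rw [hdec C W hCW])
    (forall₃_congr fun W C hWC => by rw [hinc W C hWC])

theorem isHook_append_cons_replace {s₁ s₂ : List α} {x y : α} (h : IsHook (s₁ ++ x :: s₂))
    (hmin : ∀ a ∈ s₁, a < x → ∀ c ∈ s₁, a ≤ c) (hx : ∀ b ∈ s₂, x < b) (hy : ∀ b ∈ s₂, y < b) :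
    IsHook (s₁ ++ y :: s₂) := by
  obtain ⟨-, htail, -, hlt⟩ := List.triplewise_append.1 h
  have hdec : s₁.Pairwise (· ≥ ·) := (hlt x (by simp)).imp_of_mem fun ha hb hab =>
    not_lt.1 fun h => (hmin _ hb (hab h) _ ha).not_gt h
  have hinc : s₂.Pairwise (· < ·) := (List.triplewise_cons.1 htail).1.imp_of_mem
    fun hb _ hbc => hbc (hx _ hb)
  exact isHook_append hdec (List.pairwise_cons.2 ⟨hy, hinc⟩)

theorem hookLength_append_cons_le {A B : List α} {x y : α}
    (hmin : ∀ a ∈ A, a < x → ∀ c ∈ A, a ≤ c) (hx : ∀ b ∈ B, x < b) (hy : ∀ b ∈ B, y < b) :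
    hookLength (A ++ x :: B) ≤ hookLength (A ++ y :: B) := by
  refine maxLength_le_iff.2 fun s hs hhook => ?_
  obtain hs | ⟨s₁, s₂, rfl, hs₁, hs₂⟩ := sublist_append_cons_iff.1 hs
  · exact length_le_maxLength (sublist_append_cons_iff.2 (.inl hs)) hhook
  · refine (Eq.le (by simp)).trans (length_le_maxLength (P := IsHook)
      (sublist_append_cons_iff.2 (.inr ⟨s₁, s₂, rfl, hs₁, hs₂⟩)) ?_)
    exact isHook_append_cons_replace hhook
      (fun a ha hax c hc => hmin a (hs₁.subset ha) hax c (hs₁.subset hc))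
      (fun b hb => hx b (hs₂.subset hb)) (fun b hb => hy b (hs₂.subset hb))

end Exchange

/-! ### Compatibility of two rows -/

section TwoRows

variable {α : Type*} [LinearOrder α]

theorem isHook_map_range_iff {f : ℕ → α} {m : ℕ} : IsHook ((List.range m).map f) ↔
    ∀ ⦃x y z⦄, x < y → y < z → z < m → f x < f y → f y < f z := by
  simp [IsHook, List.triplewise_iff_getElem]

theorem sublist_range_of_pairwise_lt {I : List ℕ} {m : ℕ} (hI : I.Pairwise (· < ·))
    (hIm : ∀ i ∈ I, i < m) : I.Sublist (List.range m) :=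
  List.sublist_of_subperm_of_pairwise
    (List.subperm_of_subset (hI.imp fun h => h.ne) fun i hi => List.mem_range.2 (hIm i hi))
    hI List.pairwise_lt_range

theorem length_le_of_pairwise_lt {I : List ℕ} {a b : ℕ} (hI : I.Pairwise (· < ·))
    (ha : ∀ i ∈ I, a ≤ i) (hb : ∀ i ∈ I, i < b) : I.length ≤ b - a := by
  rw [← List.toFinset_card_of_nodup (hI.imp fun h => h.ne), ← Nat.card_Ico]
  refine Finset.card_le_card fun i hi => ?_
  rw [List.mem_toFinset] at hi
  exact Finset.mem_Ico.2 ⟨ha i hi, hb i hi⟩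

/-- The conditions (S1) and (S2) on two consecutive rows `u` and `v` without empty boxes, `v` being
the lower one and of length `m`. -/
def RowsCompatible (u v : ℕ → α) (m : ℕ) : Prop :=
  (∀ i j, i ≤ j → j < m → u i ≤ v j → i ≠ 0 ∧ v (i - 1) < v j) ∧
    ∀ i j, i ≤ j → j < m → v j < u i → u (j + 1) ≤ u i

variable {u v : ℕ → α} {m₁ m₂ : ℕ}

theorem RowsCompatible.length_le_of_le (h : RowsCompatible u v m₂)
    (hv : IsHook ((List.range m₂).map v)) {J I : List ℕ} {i j : ℕ}
    (hJ : (J ++ [j]).Pairwise (· < ·)) (hJm : ∀ x ∈ J ++ [j], x < m₂)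
    (hI : (i :: I).Pairwise (· < ·)) (hIm : ∀ x ∈ i :: I, x < m₁)
    (hij : u i ≤ v j) (hdec : ∀ x ∈ J, v j ≤ v x) :
    (J ++ [j]).length + (i :: I).length ≤ m₁ := by
  have hIlen : (i :: I).length ≤ m₁ - i := length_le_of_pairwise_lt hI
    (List.forall_mem_cons.2 ⟨le_rfl, fun x hx => (List.rel_of_pairwise_cons hI hx).le⟩) hIm
  obtain ⟨hJ, -, hJj⟩ := List.pairwise_append.1 hJ
  replace hJj : ∀ x ∈ J, x < j := fun x hx => hJj x hx j (by simp)
  have hi : i < m₁ := hIm i (by simp)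
  have hj : j < m₂ := hJm j (by simp)
  simp only [List.length_append, List.length_singleton]
  rcases lt_or_ge j i with hji | hji
  · have := length_le_of_pairwise_lt hJ (fun x _ => Nat.zero_le x) hJj
    omega
  · obtain ⟨hi0, hlt⟩ := h.1 i j hji hj hij
    have hJi : ∀ x ∈ J, x < i - 1 := by
      intro x hx
      by_contra! hix
      rcases hix.eq_or_lt with rfl | hix
      · exact (hdec _ hx).not_gt hlt
      · exact (hdec x hx).not_gt
          (isHook_map_range_iff.1 hv hix (hJj x hx) hj (hlt.trans_le (hdec x hx)))
    have := length_le_of_pairwise_lt hJ (fun x _ => Nat.zero_le x) hJi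
    omega

theorem RowsCompatible.length_le_of_lt (hm : m₂ < m₁) (h : RowsCompatible u v m₂)
    (hu : IsHook ((List.range m₁).map u)) {J I : List ℕ} {i j : ℕ}
    (hJ : (J ++ [j]).Pairwise (· < ·)) (hJm : ∀ x ∈ J ++ [j], x < m₂)
    (hI : (i :: I).Pairwise (· < ·)) (hIm : ∀ x ∈ i :: I, x < m₁)
    (hji : v j < u i) (hinc : ∀ x ∈ I, u i < u x) :
    (J ++ [j]).length + (i :: I).length ≤ m₁ := by
  have hj : j < m₂ := hJm j (by simp)
  have hJlen : (J ++ [j]).length ≤ j + 1 := by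
    refine length_le_of_pairwise_lt hJ (fun x _ => Nat.zero_le x) fun x hx => ?_
    rcases List.mem_append.1 hx with hx | hx
    · exact ((List.pairwise_append.1 hJ).2.2 x hx j (by simp)).trans j.lt_succ_self
    · exact Nat.lt_succ_of_le (List.mem_singleton.1 hx).le
  obtain ⟨hiI, hI⟩ := List.pairwise_cons.1 hI
  obtain ⟨hi, hIm⟩ := List.forall_mem_cons.1 hIm
  rw [List.length_cons]
  rcases lt_or_ge j i with hlt | hle
  · have := length_le_of_pairwise_lt hI hiI hIm
    omega
  · have hjI : ∀ x ∈ I, j + 2 ≤ x := by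
      intro x hx
      by_contra! hxj
      have hle := h.2 i j hle hj hji
      rcases (Nat.lt_succ_iff.1 hxj).eq_or_lt with rfl | hxj
      · exact (hinc _ hx).not_ge hle
      · exact (isHook_map_range_iff.1 hu (hiI x hx) hxj (by omega) (hinc x hx)).not_ge
          (hle.trans (hinc x hx).le)
    have := length_le_of_pairwise_lt hI hjI hIm
    omega

theorem RowsCompatible.hookLength_le (hm : m₂ < m₁) (h : RowsCompatible u v m₂)
    (hu : IsHook ((List.range m₁).map u)) (hv : IsHook ((List.range m₂).map v)) :
    hookLength ((List.range m₂).map v ++ (List.range m₁).map u) ≤ m₁ := by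
  refine maxLength_le_iff.2 fun s hs hhook => ?_
  obtain ⟨s₂, s₁, rfl, hs₂, hs₁⟩ := List.sublist_append_iff.1 hs
  obtain ⟨J, hJ, rfl⟩ := List.sublist_map_iff.1 hs₂
  obtain ⟨I, hI, rfl⟩ := List.sublist_map_iff.1 hs₁
  have hIm : ∀ x ∈ I, x < m₁ := fun x hx => List.mem_range.1 (hI.subset hx)
  have hJm : ∀ x ∈ J, x < m₂ := fun x hx => List.mem_range.1 (hJ.subset hx)
  rw [List.length_append, List.length_map, List.length_map]
  obtain rfl | ⟨J, j, rfl⟩ := List.eq_nil_or_concat' J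
  · simpa using hI.length_le
  rcases I with - | ⟨i, I⟩
  · simpa using hJ.length_le.trans (by simpa using hm.le)
  obtain ⟨-, -, hinc, hdec⟩ := List.triplewise_append.1 hhook
  replace hI := List.pairwise_lt_range.sublist hI
  replace hJ := List.pairwise_lt_range.sublist hJ
  rcases lt_or_ge (v j) (u i) with hji | hij
  · refine h.length_le_of_lt hm hu hJ hJm hI hIm hji fun x hx => ?_
    exact List.rel_of_pairwise_cons (hinc (v j) (by simp)) (List.mem_map_of_mem hx) hji
  · refine h.length_le_of_le hv hJ hJm hI hIm hij fun x hx => ?_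
    rw [List.map_append, List.map_singleton] at hdec
    exact not_lt.1 fun hlt => hij.not_gt ((List.pairwise_append.1 (hdec (u i) (by simp))).2.2
      _ (List.mem_map_of_mem hx) (v j) (by simp) hlt)

theorem lt_of_hookLength_le (hm : m₂ < m₁) (hu : IsHook ((List.range m₁).map u))
    (hv : IsHook ((List.range m₂).map v))
    (h : hookLength ((List.range m₂).map v ++ (List.range m₁).map u) ≤ m₁) {i j : ℕ}
    (hij : i ≤ j) (hj : j < m₂) (hle : u i ≤ v j) : i ≠ 0 ∧ v (i - 1) < v j := by
  by_contra! hc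
  -- `v 0, …, v (i - 1), v j, u i, …, u (m₁ - 1)` would be a hook subword of length `m₁ + 1`.
  obtain ⟨k, rfl⟩ : ∃ k, m₁ = i + 1 + k := Nat.exists_eq_add_of_le (by omega)
  have hJ : (List.range i ++ [j]).Sublist (List.range m₂) := by
    refine sublist_range_of_pairwise_lt ?_ (by simp; omega)
    simpa [List.pairwise_append, List.pairwise_lt_range] using fun x hx => hx.trans_le hij
  have hI : (i :: List.range' (i + 1) k).Sublist (List.range (i + 1 + k)) := by
    rw [← List.range'_succ]
    exact sublist_range_of_pairwise_lt List.pairwise_lt_range' (by simp; omega)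
  have hdec : ((List.range i ++ [j]).map v).Pairwise (· ≥ ·) := by
    rcases i with - | i
    · simp
    · have hhook := hv.sublist (hJ.map v)
      simp only [List.range_succ, List.append_assoc, List.map_append, List.map_cons,
        List.map_nil, List.singleton_append] at hhook ⊢
      exact hhook.pairwise_ge (hc i.succ_ne_zero)
  have hge : ∀ a ∈ (List.range i ++ [j]).map v, u i ≤ a := by
    rw [List.map_append, List.pairwise_append] at hdec
    simp only [List.map_append, List.forall_mem_append]
    exact ⟨fun a ha => hle.trans (hdec.2.2 a ha (v j) (by simp)), by simpa using hle⟩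
  have hlen := maxLength_le_iff.1 h _ ((hJ.map v).append (hI.map u))
    (IsHook.append_left (hu.sublist (hI.map u)) hdec hge)
  simp only [List.length_append, List.length_map, List.length_cons, List.length_range,
    List.length_range', List.length_nil] at hlen
  omega

theorem le_of_hookLength_le (hm : m₂ < m₁) (hu : IsHook ((List.range m₁).map u))
    (hv : IsHook ((List.range m₂).map v))
    (h : hookLength ((List.range m₂).map v ++ (List.range m₁).map u) ≤ m₁) {i j : ℕ}
    (hij : i ≤ j) (hj : j < m₂) (hlt : v j < u i) : u (j + 1) ≤ u i := by
  by_contra! hc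
  -- `v 0, …, v j, u i, u (j + 1), …, u (m₁ - 1)` would be a hook subword of length `m₁ + 1`.
  obtain ⟨k, rfl⟩ : ∃ k, m₁ = j + 1 + 1 + k := Nat.exists_eq_add_of_le (by omega)
  have hJ : (List.range j ++ [j]).Sublist (List.range m₂) := by
    rw [← List.range_succ]
    exact List.range_sublist.2 hj
  have hI : (i :: (j + 1) :: List.range' (j + 1 + 1) k).Sublist (List.range (j + 1 + 1 + k)) := by
    rw [← List.range'_succ]
    refine sublist_range_of_pairwise_lt (List.pairwise_cons.2
      ⟨fun x hx => ?_, List.pairwise_lt_range'⟩) (List.forall_mem_cons.2 ⟨by omega, fun x hx => ?_⟩)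
    all_goals rw [List.mem_range'_1] at hx; omega
  have hinc : ((i :: (j + 1) :: List.range' (j + 1 + 1) k).map u).Pairwise (· < ·) :=
    (hu.sublist (hI.map u)).pairwise_lt hc
  have hvj : ∀ a ∈ (i :: (j + 1) :: List.range' (j + 1 + 1) k).map u, v j < a :=
    List.forall_mem_cons.2 ⟨hlt, fun a ha => hlt.trans (List.rel_of_pairwise_cons hinc ha)⟩
  have hhook := hv.sublist (hJ.map v)
  rw [List.map_append] at hhook
  have hlen := maxLength_le_iff.1 h _ ((hJ.map v).append (hI.map u)) (by
    simpa using hhook.append_right (List.pairwise_cons.2 ⟨hvj, hinc⟩))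
  simp only [List.length_append, List.length_map, List.length_cons, List.length_range,
    List.length_range', List.length_nil] at hlen
  omega

theorem rowsCompatible_iff_hookLength_le (hm : m₂ < m₁) (hu : IsHook ((List.range m₁).map u))
    (hv : IsHook ((List.range m₂).map v)) : RowsCompatible u v m₂ ↔
      hookLength ((List.range m₂).map v ++ (List.range m₁).map u) ≤ m₁ :=
  ⟨fun h => h.hookLength_le hm hu hv, fun h =>
    ⟨fun _ _ hij hj => lt_of_hookLength_le hm hu hv h hij hj,
      fun _ _ hij hj => le_of_hookLength_le hm hu hv h hij hj⟩⟩

end TwoRows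

/-! ### The operators on words -/

section Words

variable {n : ℕ}

theorem coeff_zero (i : ℕ) : Weight.coeff (0 : Weight n) i = 0 := by
  simp [Weight.coeff]

theorem coeff_add (x y : Weight n) (i : ℕ) :
    Weight.coeff (x + y) i = Weight.coeff x i + Weight.coeff y i := by
  unfold Weight.coeff
  split_ifs <;> simp

theorem coeff_eps (a : Letter n) (i : ℕ) :
    Weight.coeff (eps n a.1) i = if a.1 = i then 1 else 0 := by
  unfold Weight.coeff eps
  split_ifs <;> grind

theorem pairing_zero (i : ℕ) : Weight.pairing (0 : Weight n) i = 0 := by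
  simp only [Weight.pairing, coeff_zero, sub_self]

theorem pairing_add (x y : Weight n) (i : ℕ) :
    Weight.pairing (x + y) i = Weight.pairing x i + Weight.pairing y i := by
  simp only [Weight.pairing, coeff_add]
  ring

theorem pairing_eps (a : Letter n) (i : ℕ) :
    Weight.pairing (eps n a.1) i = letterPhi i a - letterEps i a := by
  simp only [Weight.pairing, coeff_eps, letterPhi, letterEps]

theorem letterEps_nonneg (i : ℕ) (a : Letter n) : 0 ≤ letterEps i a := by
  unfold letterEps
  split_ifs <;> simp

theorem wordWt_append (A B : List (Letter n)) : wordWt (A ++ B) = wordWt A + wordWt B := by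
  induction A with
  | nil => simp [wordWt]
  | cons a A ih => simp only [List.cons_append, wordWt, ih, add_assoc]

theorem coeff_wordWt (w : List (Letter n)) (i : ℕ) :
    Weight.coeff (wordWt w) i = (w.map Subtype.val).count i := by
  induction w with
  | nil => simp [wordWt, coeff_zero]
  | cons a w ih =>
    simp only [wordWt, coeff_add, coeff_eps, ih, List.map_cons, List.count_cons, beq_iff_eq]
    push_cast
    ring

theorem wordEps_nonneg (i : ℕ) : ∀ w : List (Letter n), 0 ≤ wordEps i w
  | [] => le_rfl
  | a :: _ => le_max_of_le_left (letterEps_nonneg i a)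

theorem wordPhi_nonneg (i : ℕ) : ∀ w : List (Letter n), 0 ≤ wordPhi i w
  | [] => le_rfl
  | _ :: w => le_max_of_le_right (wordPhi_nonneg i w)

theorem wordPhi_eq (i : ℕ) (w : List (Letter n)) :
    wordPhi i w = Weight.pairing (wordWt w) i + wordEps i w := by
  induction w with
  | nil => simp [wordPhi, wordWt, wordEps, pairing_zero]
  | cons a w ih =>
    simp only [wordPhi, wordWt, wordEps, pairing_add, pairing_eps, ih]
    grind

theorem wordEps_append (i : ℕ) (A B : List (Letter n)) :
    wordEps i (A ++ B) = max (wordEps i A) (wordEps i B - Weight.pairing (wordWt A) i) := by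
  induction A with
  | nil => simp [wordEps, wordWt, pairing_zero, wordEps_nonneg]
  | cons a A ih =>
    simp only [List.cons_append, wordEps, wordWt, pairing_add, ih]
    grind

theorem wordPhi_append (i : ℕ) (A B : List (Letter n)) :
    wordPhi i (A ++ B) = max (wordPhi i A + Weight.pairing (wordWt B) i) (wordPhi i B) := by
  simp only [wordPhi_eq, wordEps_append, wordWt_append, pairing_add]
  grind

theorem wordPhi_cons_eq_zero_iff {i : ℕ} {a : Letter n} {A : List (Letter n)} :
    wordPhi i (a :: A) = 0 ↔ wordPhi i A = 0 ∧ letterPhi i a ≤ wordEps i A := by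
  have hA := wordPhi_nonneg i A
  have hφ := wordPhi_eq i A
  rw [wordPhi]
  grind

theorem letterE_eq_some_iff {i : ℕ} {a b : Letter n} :
    letterE i a = some b ↔ b.1 = i ∧ a.1 = i + 1 := by
  have := b.2
  unfold letterE
  split_ifs <;> simp [Subtype.ext_iff] <;> omega

theorem letterF_eq_some_iff {i : ℕ} {a b : Letter n} :
    letterF i a = some b ↔ a.1 = i ∧ b.1 = i + 1 := by
  have := b.2
  unfold letterF
  split_ifs <;> simp [Subtype.ext_iff] <;> omega

/-- The word `w'` arises from `w` by changing one letter `x` to a letter `y` with `r x y`, where the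
words `A` to the left and `B` to the right of this letter satisfy `C A B`. -/
def Replaces {α : Type*} (r : α → α → Prop) (C : List α → List α → Prop) (w w' : List α) : Prop :=
  ∃ A x y B, w = A ++ x :: B ∧ w' = A ++ y :: B ∧ r x y ∧ C A B

theorem replaces_flip {α : Type*} {r : α → α → Prop} {C : List α → List α → Prop}
    {w w' : List α} : Replaces (flip r) C w w' ↔ Replaces r C w' w := by
  constructor <;> exact fun ⟨A, x, y, B, hw, hw', h⟩ => ⟨A, y, x, B, hw', hw, h⟩

/-- The conditions say which letter of a word is acted on by an operator `op` that is defined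
recursively by a tensor product rule: `c a w` decides if `op (a ⊗ w)` acts on `a`. -/
theorem eq_some_iff_replaces {α : Type*} {op : List α → Option (List α)} {g : α → Option α}
    {c : α → List α → Prop} [∀ a w, Decidable (c a w)] {C : List α → List α → Prop}
    {r : α → α → Prop} (op_nil : op [] = none)
    (op_cons : ∀ a w, op (a :: w) =
      if c a w then (g a).map (fun b => b :: w) else (op w).map (fun w' => a :: w'))
    (hg : ∀ x y, g x = some y ↔ r x y) (hnil : ∀ x y B, r x y → (C [] B ↔ c x B))
    (hcons : ∀ a A x y B, r x y → (C (a :: A) B ↔ C A B ∧ ¬ c a (A ++ x :: B)))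
    {w w' : List α} : op w = some w' ↔ Replaces r C w w' := by
  induction w generalizing w' with
  | nil => simp [op_nil, Replaces]
  | cons a w ih =>
    rw [op_cons]
    split_ifs with hc
    · simp only [Option.map_eq_some_iff, hg]
      constructor
      · rintro ⟨y, hy, rfl⟩
        exact ⟨[], a, y, w, rfl, rfl, hy, (hnil a y w hy).2 hc⟩
      · rintro ⟨_ | ⟨b, A⟩, x, y, B, hw, rfl, hr, hC⟩ <;> obtain ⟨rfl, rfl⟩ := List.cons.inj hw
        · exact ⟨y, hr, rfl⟩
        · exact absurd hc ((hcons _ _ x y _ hr).1 hC).2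
    · simp only [Option.map_eq_some_iff, ih]
      constructor
      · rintro ⟨_, ⟨A, x, y, B, rfl, rfl, hr, hC⟩, rfl⟩
        exact ⟨a :: A, x, y, B, rfl, rfl, hr, (hcons _ _ x y _ hr).2 ⟨hC, hc⟩⟩
      · rintro ⟨_ | ⟨b, A⟩, x, y, B, hw, rfl, hr, hC⟩ <;> obtain ⟨rfl, rfl⟩ := List.cons.inj hw
        · exact absurd ((hnil _ _ _ hr).1 hC) hc
        · exact ⟨A ++ y :: B, ⟨A, x, y, B, rfl, rfl, hr, ((hcons _ _ x y _ hr).1 hC).1⟩, rfl⟩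

/-- The operators of index `i` exchange the letters `i.letter` and `i.letter + 1`. -/
def QIndex.letter : QIndex n → ℕ
  | .gl i => i.1
  | .bar => 1

/-- The condition on the words `A` and `B` under which the operators of index `i` act on the letter
`x` of `A ⊗ x ⊗ B`, if they act on the letter `x` at all. -/
def QIndex.ActsBetween : QIndex n → List (Letter n) → List (Letter n) → Prop
  | .gl i, A, B => wordPhi i.1 A = 0 ∧ wordEps i.1 B = 0
  | .bar, _, B => Weight.coeff (wordWt B) 1 = 0 ∧ Weight.coeff (wordWt B) 2 = 0

/-- The relation `w' = f̃ᵢ w`. -/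
def LoweringStep (i : QIndex n) : List (Letter n) → List (Letter n) → Prop :=
  Replaces (fun x y => x.1 = i.letter ∧ y.1 = i.letter + 1) i.ActsBetween

theorem wordEps_append_cons {i : ℕ} {A B : List (Letter n)} {x : Letter n}
    (hx : x.1 = i ∨ x.1 = i + 1) (hA : wordPhi i A = 0) (hB : wordEps i B = 0) :
    wordEps i (A ++ x :: B) = wordEps i A + letterEps i x := by
  have hφ := wordPhi_eq i A
  simp only [wordEps_append, wordEps, pairing_eps]
  unfold letterEps letterPhi
  grind

theorem wordF_eq_some_iff {i : GlIndex n} {w w' : List (Letter n)} :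
    wordF i.1 w = some w' ↔ LoweringStep (.gl i) w w' := by
  refine eq_some_iff_replaces rfl (fun _ _ => rfl) (fun _ _ => letterF_eq_some_iff) ?_ ?_ <;>
    simp only [QIndex.letter, QIndex.ActsBetween]
  · rintro x y B ⟨hx, -⟩
    have := wordEps_nonneg i.1 B
    simp only [wordPhi, letterPhi, if_pos hx]
    grind
  · rintro a A x y B ⟨hx, -⟩
    have hε := @wordEps_append_cons _ i.1 A B x (.inl hx)
    rw [letterEps, if_neg (by omega), add_zero] at hε
    rw [wordPhi_cons_eq_zero_iff]
    grind

theorem wordE_eq_some_iff {i : GlIndex n} {w w' : List (Letter n)} :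
    wordE i.1 w' = some w ↔ LoweringStep (.gl i) w w' := by
  refine (eq_some_iff_replaces rfl (fun _ _ => rfl) (fun _ _ => letterE_eq_some_iff) ?_ ?_).trans
    replaces_flip <;> simp only [QIndex.letter, QIndex.ActsBetween]
  · rintro x y B ⟨-, hx⟩
    have := wordEps_nonneg i.1 B
    simp only [wordPhi, letterPhi, if_neg (show x.1 ≠ i.1 by omega)]
    grind
  · rintro a A x y B ⟨-, hx⟩
    have hε := @wordEps_append_cons _ i.1 A B x (.inr hx)
    rw [letterEps, if_pos hx] at hε
    rw [wordPhi_cons_eq_zero_iff]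
    grind

theorem coeff_append_cons_ne_zero {x : Letter n} (hx : x.1 = 1 ∨ x.1 = 2)
    (A B : List (Letter n)) : ¬ (Weight.coeff (wordWt (A ++ x :: B)) 1 = 0 ∧
      Weight.coeff (wordWt (A ++ x :: B)) 2 = 0) := by
  rintro ⟨h₁, h₂⟩
  simp only [coeff_wordWt, Nat.cast_eq_zero, List.count_eq_zero] at h₁ h₂
  grind

theorem wordFBar_eq_some_iff {w w' : List (Letter n)} :
    wordFBar w = some w' ↔ LoweringStep .bar w w' := by
  refine eq_some_iff_replaces rfl (fun _ _ => rfl) (fun _ _ => letterF_eq_some_iff) ?_ ?_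
  · exact fun _ _ _ _ => Iff.rfl
  · exact fun _ A x _ B hxy => (and_iff_left (coeff_append_cons_ne_zero (.inl hxy.1) A B)).symm

theorem wordEBar_eq_some_iff {w w' : List (Letter n)} :
    wordEBar w' = some w ↔ LoweringStep .bar w w' := by
  refine (eq_some_iff_replaces rfl (fun _ _ => rfl) (fun _ _ => letterE_eq_some_iff) ?_ ?_).trans
    replaces_flip
  · exact fun _ _ _ _ => Iff.rfl
  · exact fun _ A x _ B hxy => (and_iff_left (coeff_append_cons_ne_zero (.inr hxy.2) A B)).symm

theorem wordCrystal_f_eq_some_iff {i : QIndex n} {w w' : List (Letter n)} :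
    (wordCrystal n).f i w = some w' ↔ LoweringStep i w w' :=
  match i with
  | .gl _ => wordF_eq_some_iff
  | .bar => wordFBar_eq_some_iff

theorem wordCrystal_e_eq_some_iff {i : QIndex n} {w w' : List (Letter n)} :
    (wordCrystal n).e i w' = some w ↔ LoweringStep i w w' :=
  match i with
  | .gl _ => wordE_eq_some_iff
  | .bar => wordEBar_eq_some_iff

end Words

/-! ### The `q(n)`-crystal of words -/

section Commutation

variable {α : Type*} {P Q : α → Prop} {r s : α → α → Prop} {C D : List α → List α → Prop}

/-- The relation `C` does not depend on the letters with `P` in its arguments. -/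
def IgnoresLetters (P : α → Prop) (C : List α → List α → Prop) : Prop :=
  ∀ x, P x → ∀ A B E, (C (A ++ x :: B) E ↔ C (A ++ B) E) ∧ (C E (A ++ x :: B) ↔ C E (A ++ B))

theorem Replaces.exists_comm (hr : ∀ x y, r x y → P x ∧ P y) (hs : ∀ x y, s x y → Q x ∧ Q y)
    (hPQ : ∀ x, P x → ¬ Q x) (hC : IgnoresLetters Q C) (hD : IgnoresLetters P D)
    {w w₁ w₂ : List α} (h₁ : Replaces r C w w₁) (h₂ : Replaces s D w₁ w₂) :
    ∃ w', Replaces s D w w' ∧ Replaces r C w' w₂ := by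
  obtain ⟨A, x, y, B, rfl, rfl, hxy, hAB⟩ := h₁
  obtain ⟨A', x', y', B', hw, rfl, hxy', hAB'⟩ := h₂
  obtain ⟨hx, hy⟩ := hr x y hxy
  obtain ⟨hx', hy'⟩ := hs x' y' hxy'
  obtain ⟨M, rfl, rfl⟩ | ⟨_ | ⟨b, M⟩, rfl, hM⟩ := append_eq_append_cons_iff.1 hw
  · refine ⟨A' ++ y' :: (M ++ x :: B), ⟨A', x', y', M ++ x :: B, by simp, rfl, hxy', ?_⟩,
      A' ++ y' :: M, x, y, B, by simp, by simp, hxy, ?_⟩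
    · exact (hD x hx M B A').2.2 ((hD y hy M B A').2.1 hAB')
    · exact (hC y' hy' A' M B).1.2 ((hC x' hx' A' M B).1.1 hAB)
  · exact absurd hx' (hPQ x' ((List.cons.inj hM).1 ▸ hy))
  · obtain ⟨rfl, rfl⟩ := List.cons.inj hM
    refine ⟨A ++ x :: (M ++ y' :: B'), ⟨A ++ x :: M, x', y', B', by simp, by simp, hxy', ?_⟩,
      A, x, y, M ++ y' :: B', rfl, by simp, hxy, ?_⟩
    · exact (hD x hx A M B').1.2 ((hD y hy A M B').1.1 hAB')
    · exact (hC y' hy' M B' A).2.2 ((hC x' hx' M B' A).2.1 hAB)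

theorem bind_comm_of_replaces {op op' : List α → Option (List α)}
    (hr : ∀ x y, r x y → P x ∧ P y) (hs : ∀ x y, s x y → Q x ∧ Q y) (hPQ : ∀ x, P x → ¬ Q x)
    (hC : IgnoresLetters Q C) (hD : IgnoresLetters P D)
    (hop : ∀ w w', op w = some w' ↔ Replaces r C w w')
    (hop' : ∀ w w', op' w = some w' ↔ Replaces s D w w') (w : List α) :
    (op w).bind op' = (op' w).bind op := by
  ext w₂
  simp only [Option.bind_eq_some_iff, hop, hop']
  exact ⟨fun ⟨_, h₁, h₂⟩ => h₁.exists_comm hr hs hPQ hC hD h₂,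
    fun ⟨_, h₁, h₂⟩ => h₁.exists_comm hs hr (fun x hQ hP => hPQ x hP hQ) hD hC h₂⟩

end Commutation

section WordCrystal

variable {n : ℕ}

theorem wordEps_append_cons_of_ne {i : ℕ} {x : Letter n} (h₁ : x.1 ≠ i) (h₂ : x.1 ≠ i + 1)
    (A B : List (Letter n)) : wordEps i (A ++ x :: B) = wordEps i (A ++ B) := by
  simp only [wordEps_append, wordEps, pairing_eps, letterEps, letterPhi, if_neg h₁, if_neg h₂,
    sub_zero, max_eq_right (wordEps_nonneg i B)]

theorem coeff_append_cons_of_ne {i : ℕ} {x : Letter n} (h : x.1 ≠ i) (A B : List (Letter n)) :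
    Weight.coeff (wordWt (A ++ x :: B)) i = Weight.coeff (wordWt (A ++ B)) i := by
  simp only [wordWt_append, wordWt, coeff_add, coeff_eps, if_neg h, zero_add]

theorem wordPhi_append_cons_of_ne {i : ℕ} {x : Letter n} (h₁ : x.1 ≠ i) (h₂ : x.1 ≠ i + 1)
    (A B : List (Letter n)) : wordPhi i (A ++ x :: B) = wordPhi i (A ++ B) := by
  simp only [wordPhi_eq, Weight.pairing, coeff_append_cons_of_ne h₁, coeff_append_cons_of_ne h₂,
    wordEps_append_cons_of_ne h₁ h₂]

/-- The letters that are changed by the operators of index `i`. -/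
def QIndex.Moves (i : QIndex n) (x : Letter n) : Prop := x.1 = i.letter ∨ x.1 = i.letter + 1

theorem ignoresLetters_actsBetween {i j : QIndex n} (h : i.letter + 1 < j.letter ∨
    j.letter + 1 < i.letter) : IgnoresLetters i.Moves j.ActsBetween := by
  intro x hx A B E
  have h₁ : x.1 ≠ j.letter := by rcases hx with hx | hx <;> omega
  have h₂ : x.1 ≠ j.letter + 1 := by rcases hx with hx | hx <;> omega
  rcases j with j | _ <;> simp only [QIndex.letter] at h₁ h₂
  · simp only [QIndex.ActsBetween, wordEps_append_cons_of_ne h₁ h₂,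
      wordPhi_append_cons_of_ne h₁ h₂, and_self]
  · simp only [QIndex.ActsBetween, coeff_append_cons_of_ne h₁, coeff_append_cons_of_ne h₂, and_self]

theorem LoweringStep.wordWt_eq {i : QIndex n} {w w' : List (Letter n)} (h : LoweringStep i w w') :
    wordWt w' = wordWt w - simpleRoot n i.letter := by
  obtain ⟨A, x, y, B, rfl, rfl, ⟨hx, hy⟩, -⟩ := h
  simp only [wordWt_append, wordWt, hx, hy, simpleRoot]
  abel

theorem wordPhi_append_cons {i : ℕ} {A B : List (Letter n)} {x : Letter n}
    (hx : x.1 = i ∨ x.1 = i + 1) (hA : wordPhi i A = 0) (hB : wordEps i B = 0) :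
    wordPhi i (A ++ x :: B) = letterPhi i x + wordPhi i B := by
  have hφ := wordPhi_eq i A
  rw [wordPhi_eq, wordPhi_eq i B, wordEps_append_cons hx hA hB, wordWt_append, wordWt, pairing_add,
    pairing_add, pairing_eps]
  linarith

theorem LoweringStep.wordEps_eq {i : GlIndex n} {w w' : List (Letter n)}
    (h : LoweringStep (.gl i) w w') : wordEps i.1 w' = wordEps i.1 w + 1 := by
  obtain ⟨A, x, y, B, rfl, rfl, ⟨hx, hy⟩, hA, hB⟩ := h
  rw [QIndex.letter] at hx hy
  rw [wordEps_append_cons (.inl hx) hA hB, wordEps_append_cons (.inr hy) hA hB, letterEps,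
    letterEps, if_pos hy, if_neg (by omega), add_zero]

theorem LoweringStep.wordPhi_eq {i : GlIndex n} {w w' : List (Letter n)}
    (h : LoweringStep (.gl i) w w') : wordPhi i.1 w = wordPhi i.1 w' + 1 := by
  obtain ⟨A, x, y, B, rfl, rfl, ⟨hx, hy⟩, hA, hB⟩ := h
  rw [QIndex.letter] at hx hy
  rw [wordPhi_append_cons (.inl hx) hA hB, wordPhi_append_cons (.inr hy) hA hB, letterPhi,
    letterPhi, if_pos hx, if_neg (by omega), zero_add, add_comm]

theorem LoweringStep.wordEps_eq_of_bar {i : ℕ} (hi : 3 ≤ i) {w w' : List (Letter n)}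
    (h : LoweringStep .bar w w') : wordEps i w' = wordEps i w := by
  obtain ⟨A, x, y, B, rfl, rfl, ⟨hx, hy⟩, -⟩ := h
  rw [QIndex.letter] at hx hy
  rw [wordEps_append_cons_of_ne (by omega) (by omega),
    wordEps_append_cons_of_ne (by omega) (by omega)]

theorem LoweringStep.wordPhi_eq_of_bar {i : ℕ} (hi : 3 ≤ i) {w w' : List (Letter n)}
    (h : LoweringStep .bar w w') : wordPhi i w' = wordPhi i w := by
  obtain ⟨A, x, y, B, rfl, rfl, ⟨hx, hy⟩, -⟩ := h
  rw [QIndex.letter] at hx hy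
  rw [wordPhi_append_cons_of_ne (by omega) (by omega),
    wordPhi_append_cons_of_ne (by omega) (by omega)]

theorem exists_replaces {i : QIndex n} {op : List (Letter n) → Option (List (Letter n))}
    (hop : op = (wordCrystal n).e i ∨ op = (wordCrystal n).f i) :
    ∃ r : Letter n → Letter n → Prop, (∀ x y, r x y → i.Moves x ∧ i.Moves y) ∧
      ∀ w w', op w = some w' ↔ Replaces r i.ActsBetween w w' := by
  obtain rfl | rfl := hop
  · exact ⟨_, fun _ _ h => ⟨.inr h.2, .inl h.1⟩,
      fun _ _ => wordCrystal_e_eq_some_iff.trans replaces_flip.symm⟩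
  · exact ⟨_, fun _ _ h => ⟨.inl h.1, .inr h.2⟩, fun _ _ => wordCrystal_f_eq_some_iff⟩

theorem wordCrystal_bind_comm {i j : QIndex n} (h : i.letter + 1 < j.letter)
    {op op' : List (Letter n) → Option (List (Letter n))}
    (hop : op = (wordCrystal n).e i ∨ op = (wordCrystal n).f i)
    (hop' : op' = (wordCrystal n).e j ∨ op' = (wordCrystal n).f j) (w : List (Letter n)) :
    (op' w).bind op = (op w).bind op' := by
  obtain ⟨r, hr, hop⟩ := exists_replaces hop
  obtain ⟨s, hs, hop'⟩ := exists_replaces hop'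
  refine bind_comm_of_replaces hs hr (fun x => ?_) (ignoresLetters_actsBetween (.inl h))
    (ignoresLetters_actsBetween (.inr h)) hop' hop w
  unfold QIndex.Moves
  omega

theorem wordCrystal_isQCrystal : (wordCrystal n).IsQCrystal where
  phi_eq i w := by
    simp only [wordCrystal, wordPhi_eq, WithBot.coe_add]
  e_spec i w w' h := by
    have h := wordCrystal_e_eq_some_iff.1 h
    refine ⟨?_, ?_, (eq_sub_iff_add_eq.1 h.wordWt_eq).symm⟩ <;>
      simp only [wordCrystal, ← WithBot.coe_add, WithBot.coe_inj]
    · exact eq_add_neg_of_add_eq h.wordEps_eq.symm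
    · exact h.wordPhi_eq
  f_spec i w w' h := by
    have h := wordCrystal_f_eq_some_iff.1 h
    refine ⟨?_, ?_, h.wordWt_eq⟩ <;> simp only [wordCrystal, ← WithBot.coe_add, WithBot.coe_inj]
    · exact h.wordEps_eq
    · exact eq_add_neg_of_add_eq h.wordPhi_eq.symm
  f_iff_e i w w' := wordCrystal_f_eq_some_iff.trans wordCrystal_e_eq_some_iff.symm
  eq_none_of_bot i w h := absurd h WithBot.coe_ne_bot
  wt_nonneg w k := by
    have h := coeff_wordWt w k.1
    rw [Weight.coeff, dif_pos k.2] at h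
    exact (Int.natCast_nonneg _).trans_eq h.symm
  wt_e_bar w w' h := (eq_sub_iff_add_eq.1 (wordCrystal_e_eq_some_iff.1 h).wordWt_eq).symm
  wt_f_bar w w' h := (wordCrystal_f_eq_some_iff.1 h).wordWt_eq
  f_bar_iff_e_bar w w' := wordCrystal_f_eq_some_iff.trans wordCrystal_e_eq_some_iff.symm
  e_bar_comm_e i hi := wordCrystal_bind_comm (i := .bar) (j := .gl i) hi (.inl rfl) (.inl rfl)
  e_bar_comm_f i hi := wordCrystal_bind_comm (i := .bar) (j := .gl i) hi (.inl rfl) (.inr rfl)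
  f_bar_comm_e i hi := wordCrystal_bind_comm (i := .bar) (j := .gl i) hi (.inr rfl) (.inl rfl)
  f_bar_comm_f i hi := wordCrystal_bind_comm (i := .bar) (j := .gl i) hi (.inr rfl) (.inr rfl)
  e_bar_string i hi w w' h := by
    have h := wordCrystal_e_eq_some_iff.1 h
    exact ⟨congrArg WithBot.some (h.wordEps_eq_of_bar hi).symm,
      congrArg WithBot.some (h.wordPhi_eq_of_bar hi).symm⟩

end WordCrystal

/-! ### Exchanging letters in a word -/

section Contexts

/-- The context condition under which the letters `x` and `x + 1` can be exchanged between the words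
`A` and `B`. The two cases belong to the operators with indices in `{1, …, n - 1}` and to
those with index `1̄`. -/
def Exchangeable (x : ℕ) (A B : List ℕ) : Prop :=
  Balanced x (x + 1) A B ∨ x = 1 ∧ 1 ∉ B ∧ 2 ∉ B

variable {x : ℕ} {A B : List ℕ}

theorem Balanced.of_filter {α : Type*} [DecidableEq α] {p q : α} {A B : List α} {P : α → Bool}
    (hp : P p) (hq : P q) (h : Balanced p q (A.filter P) (B.filter P)) : Balanced p q A B := by
  refine ⟨fun S hS => ?_, fun S hS => ?_⟩
  · simpa only [List.count_filter hp, List.count_filter hq] using h.1 _ (hS.filter P)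
  · simpa only [List.count_filter hp, List.count_filter hq] using h.2 _ (hS.filter P)

theorem Exchangeable.of_filter {n : ℕ} (hx : x + 1 ≤ n)
    (h : Exchangeable x (A.filter (· ≤ n)) (B.filter (· ≤ n))) : Exchangeable x A B := by
  refine h.imp (Balanced.of_filter (by simp; omega) (by simpa)) fun ⟨hx₁, h₁, h₂⟩ => ⟨hx₁, ?_, ?_⟩
  · exact fun h => h₁ (List.mem_filter.2 ⟨h, by simp; omega⟩)
  · exact fun h => h₂ (List.mem_filter.2 ⟨h, by simp; omega⟩)

theorem Exchangeable.of_append {A₀ B₀ : List ℕ} (h : Exchangeable x (A₀ ++ A) (B ++ B₀)) :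
    Exchangeable x A B := by
  refine h.imp (fun h => h.of_append_left.of_append_right) fun ⟨hx, h₁, h₂⟩ => ⟨hx, ?_, ?_⟩
  · exact fun h => h₁ (List.mem_append_left _ h)
  · exact fun h => h₂ (List.mem_append_left _ h)

theorem Exchangeable.hookLength_eq (h : Exchangeable x A B) (hA : ∀ a ∈ A, 1 ≤ a)
    (hB : ∀ b ∈ B, 1 ≤ b) : hookLength (A ++ x :: B) = hookLength (A ++ (x + 1) :: B) := by
  obtain h | ⟨rfl, h₁, h₂⟩ := h
  · exact h.hookLength_eq (Order.covBy_add_one x)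
  have hB : ∀ b ∈ B, 2 < b := fun b hb => by
    have := hB b hb
    have := ne_of_mem_of_not_mem hb h₁
    have := ne_of_mem_of_not_mem hb h₂
    omega
  refine le_antisymm (hookLength_append_cons_le ?_ ?_ ?_) (hookLength_append_cons_le ?_ ?_ ?_)
  all_goals grind

theorem Exchangeable.hookLength_map {β : Type*} {f g : β → ℕ} {X₁ X₂ M : List β} {b : β}
    (h : Exchangeable (f b) (X₁.map f) (X₂.map f)) (hpos : ∀ c, 1 ≤ f c) (hb : g b = f b + 1)
    (hfg : ∀ c, c ≠ b → f c = g c) (hnodup : (X₁ ++ b :: X₂).Nodup)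
    (hM : M <:+: X₁ ++ b :: X₂) : hookLength (M.map f) = hookLength (M.map g) := by
  have hmap : ∀ L : List β, b ∉ L → L.map f = L.map g := fun L hL =>
    List.map_congr_left fun c hc => hfg c (ne_of_mem_of_not_mem hc hL)
  by_cases hbM : b ∈ M
  · obtain ⟨M₁, M₂, rfl⟩ := List.append_of_mem hbM
    obtain ⟨L, R, hLR⟩ := hM
    have hbX := (List.nodup_cons.1 (List.nodup_middle.1 hnodup)).1
    rw [List.mem_append, not_or] at hbX
    have hsplit : X₁ ++ b :: X₂ = (L ++ M₁) ++ b :: (M₂ ++ R) := by simp [← hLR]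
    obtain ⟨rfl, -, rfl⟩ := (List.append_cons_inj_of_notMem hbX.1 hbX.2).1 hsplit
    simp only [List.mem_append, not_or] at hbX
    rw [List.map_append, List.map_append] at h
    simp only [List.map_append, List.map_cons, ← hmap M₁ hbX.1.2, ← hmap M₂ hbX.2.1, hb]
    exact h.of_append.hookLength_eq (by simp [hpos]) (by simp [hpos])
  · rw [hmap M hbM]

theorem wordPhi_eq_zero_of_suffix {n i : ℕ} {A S : List (Letter n)} (h : S <:+ A)
    (hA : wordPhi i A = 0) : wordPhi i S = 0 := by
  obtain ⟨A₀, rfl⟩ := h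
  rw [wordPhi_append] at hA
  exact (wordPhi_nonneg i S).antisymm' (hA ▸ le_max_right _ _)

theorem wordEps_eq_zero_of_prefix {n i : ℕ} {B S : List (Letter n)} (h : S <+: B)
    (hB : wordEps i B = 0) : wordEps i S = 0 := by
  obtain ⟨B₀, rfl⟩ := h
  rw [wordEps_append] at hB
  exact (wordEps_nonneg i S).antisymm' (hB ▸ le_max_left _ _)

theorem balanced_map_val {n i : ℕ} {A B : List (Letter n)} (hA : wordPhi i A = 0)
    (hB : wordEps i B = 0) :
    Balanced i (i + 1) (A.map Subtype.val) (B.map Subtype.val) := by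
  refine ⟨fun S hS => ?_, fun S hS => ?_⟩
  · obtain ⟨S, hS', rfl⟩ := List.suffix_map_iff.1 hS
    have hS := wordPhi_eq_zero_of_suffix hS' hA
    rw [wordPhi_eq, Weight.pairing, coeff_wordWt, coeff_wordWt] at hS
    have := wordEps_nonneg i S
    omega
  · obtain ⟨S, hS', rfl⟩ := List.prefix_map_iff.1 hS
    have hS := wordEps_eq_zero_of_prefix hS' hB
    have hφ := wordPhi_nonneg i S
    rw [wordPhi_eq, Weight.pairing, coeff_wordWt, coeff_wordWt] at hφ
    omega

theorem QIndex.ActsBetween.exchangeable {n : ℕ} {i : QIndex n} {A B : List (Letter n)}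
    (h : i.ActsBetween A B) :
    Exchangeable i.letter (A.map Subtype.val) (B.map Subtype.val) := by
  rcases i with i | _
  · exact .inl (balanced_map_val h.1 h.2)
  · simp only [QIndex.ActsBetween, coeff_wordWt, Nat.cast_eq_zero, List.count_eq_zero] at h
    exact .inr ⟨rfl, h⟩

end Contexts

/-! ### Crystals induced along injective maps -/

section InducedCrystals

variable {B B' : Type*} {g : B → B'} {n : ℕ} {D : CrystalData n B'} {C : CrystalData n B}

/-- Strict morphisms of crystals: `g` commutes with all maps of the two crystals, where
`g 0 = 0`. -/
structure CrystalData.IsStrictMorphism (C : CrystalData n B) (D : CrystalData n B') (g : B → B') :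
    Prop where
  wt : ∀ b, C.wt b = D.wt (g b)
  ε : ∀ i b, C.ε i b = D.ε i (g b)
  φ : ∀ i b, C.φ i b = D.φ i (g b)
  e : ∀ i b, (C.e i b).map g = D.e i (g b)
  f : ∀ i b, (C.f i b).map g = D.f i (g b)

theorem eq_some_iff_of_map {F : B → Option B} {G : B' → Option B'} (hg : Function.Injective g)
    (h : ∀ b, (F b).map g = G (g b)) {b b' : B} : F b = some b' ↔ G (g b) = some (g b') := by
  rw [← h, ← Option.map_some, (Option.map_injective hg).eq_iff]

theorem bind_comm_of_map {F₁ F₂ : B → Option B} {G₁ G₂ : B' → Option B'}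
    (hg : Function.Injective g) (h₁ : ∀ b, (F₁ b).map g = G₁ (g b))
    (h₂ : ∀ b, (F₂ b).map g = G₂ (g b)) {b : B}
    (h : (G₁ (g b)).bind G₂ = (G₂ (g b)).bind G₁) : (F₁ b).bind F₂ = (F₂ b).bind F₁ := by
  rw [← h₁, ← h₂, Option.bind_map, Option.bind_map] at h
  apply Option.map_injective hg
  rw [Option.map_bind, Option.map_bind]
  rwa [show Option.map g ∘ F₂ = G₂ ∘ g from funext h₂,
    show Option.map g ∘ F₁ = G₁ ∘ g from funext h₁]

namespace CrystalData.IsStrictMorphism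

variable (h : C.IsStrictMorphism D g) (hg : Function.Injective g)
include h hg

theorem isGlCrystal (hD : D.IsGlCrystal) : C.IsGlCrystal where
  phi_eq i b := by simpa only [h.wt, h.ε, h.φ] using hD.phi_eq i (g b)
  e_spec i b b' hb := by
    simpa only [h.wt, h.ε, h.φ] using
      hD.e_spec i (g b) (g b') ((eq_some_iff_of_map hg (h.e _)).1 hb)
  f_spec i b b' hb := by
    simpa only [h.wt, h.ε, h.φ] using
      hD.f_spec i (g b) (g b') ((eq_some_iff_of_map hg (h.f _)).1 hb)
  f_iff_e i b b' := by
    simpa only [eq_some_iff_of_map hg (h.e _), eq_some_iff_of_map hg (h.f _)] using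
      hD.f_iff_e i (g b) (g b')
  eq_none_of_bot i b hb := by
    simpa only [← h.e, ← h.f, Option.map_eq_none_iff] using
      hD.eq_none_of_bot i (g b) (h.φ i b ▸ hb)

theorem isQCrystal (hD : D.IsQCrystal) : C.IsQCrystal where
  toIsGlCrystal := h.isGlCrystal hg hD.toIsGlCrystal
  wt_nonneg b k := by simpa only [h.wt] using hD.wt_nonneg (g b) k
  wt_e_bar b b' hb := by
    simpa only [h.wt] using hD.wt_e_bar _ _ ((eq_some_iff_of_map hg (h.e _)).1 hb)
  wt_f_bar b b' hb := by
    simpa only [h.wt] using hD.wt_f_bar _ _ ((eq_some_iff_of_map hg (h.f _)).1 hb)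
  f_bar_iff_e_bar b b' := by
    simpa only [eq_some_iff_of_map hg (h.e _), eq_some_iff_of_map hg (h.f _)] using
      hD.f_bar_iff_e_bar (g b) (g b')
  e_bar_comm_e i hi b := bind_comm_of_map hg (h.e _) (h.e _) (hD.e_bar_comm_e i hi (g b))
  e_bar_comm_f i hi b := bind_comm_of_map hg (h.f _) (h.e _) (hD.e_bar_comm_f i hi (g b))
  f_bar_comm_e i hi b := bind_comm_of_map hg (h.e _) (h.f _) (hD.f_bar_comm_e i hi (g b))
  f_bar_comm_f i hi b := bind_comm_of_map hg (h.f _) (h.f _) (hD.f_bar_comm_f i hi (g b))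
  e_bar_string i hi b b' hb := by
    simpa only [h.ε, h.φ] using
      hD.e_bar_string i hi _ _ ((eq_some_iff_of_map hg (h.e _)).1 hb)

end CrystalData.IsStrictMorphism

/-- The crystal maps on `B` induced from `D` through `g`. A value outside the range of `g` becomes
`0`. -/
noncomputable def CrystalData.comap (D : CrystalData n B') (g : B → B') : CrystalData n B where
  wt b := D.wt (g b)
  ε i b := D.ε i (g b)
  φ i b := D.φ i (g b)
  e i b := (D.e i (g b)).bind (Function.partialInv g)
  f i b := (D.f i (g b)).bind (Function.partialInv g)

theorem map_bind_partialInv (hg : Function.Injective g) {x : Option B'}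
    (hx : ∀ y, x = some y → y ∈ Set.range g) :
    (x.bind (Function.partialInv g)).map g = x := by
  obtain _ | y := x
  · rfl
  · obtain ⟨b, rfl⟩ := hx y rfl
    rw [Option.bind_some, Function.partialInv_left hg, Option.map_some]

theorem CrystalData.comap_isStrictMorphism (hg : Function.Injective g)
    (he : ∀ i b w, D.e i (g b) = some w → w ∈ Set.range g)
    (hf : ∀ i b w, D.f i (g b) = some w → w ∈ Set.range g) :
    (D.comap g).IsStrictMorphism D g where
  wt _ := rfl
  ε _ _ := rfl
  φ _ _ := rfl
  e i b := map_bind_partialInv hg (he i b)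
  f i b := map_bind_partialInv hg (hf i b)

end InducedCrystals

/-! ### Tableaux and their reading words -/

namespace StrictPartition

theorem part_antitone (lam : StrictPartition) : Antitone lam.part :=
  antitone_nat_of_succ_le lam.part_succ_le

theorem part_succ_lt (lam : StrictPartition) {k : ℕ} (h : lam.part (k + 1) ≠ 0) :
    lam.part (k + 1) < lam.part k :=
  (lam.part_succ_le k).lt_of_ne fun heq => h (heq.trans (lam.eq_zero_of_eq k heq.symm))

theorem lt_length_of_part_ne_zero (lam : StrictPartition) {k : ℕ} (h : lam.part k ≠ 0) :
    k < lam.length := by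
  have hsub : Set.Iic k ⊆ Function.support lam.part := fun p hp =>
    ((Nat.pos_of_ne_zero h).trans_le (lam.part_antitone hp)).ne'
  calc k < (Set.Iic k).ncard := by simp [Set.ncard_eq_toFinset_card']
    _ ≤ lam.length := Set.ncard_le_ncard hsub lam.finite_support

theorem mk_mem_shiftedDiagram (lam : StrictPartition) {p q : ℕ} :
    (p, p + q) ∈ lam.shiftedDiagram ↔ q < lam.part p := by
  simp [shiftedDiagram]

/-- The coordinates of the boxes in row `p`, from left to right. -/
def rowBoxes (lam : StrictPartition) (p : ℕ) : List (ℕ × ℕ) :=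
  (List.range (lam.part p)).map fun q => (p, p + q)

/-- The coordinates of the boxes of the shifted diagram, in the order in which `revWord` reads
them. -/
noncomputable def boxes (lam : StrictPartition) : List (ℕ × ℕ) :=
  (List.range lam.length).reverse.flatMap lam.rowBoxes

variable {lam : StrictPartition}

theorem mem_rowBoxes {p : ℕ} {c : ℕ × ℕ} :
    c ∈ lam.rowBoxes p ↔ c ∈ lam.shiftedDiagram ∧ c.1 = p := by
  simp only [rowBoxes, List.mem_map, List.mem_range, shiftedDiagram]
  constructor
  · rintro ⟨q, hq, rfl⟩
    simpa
  · rintro ⟨⟨h₁, h₂⟩, rfl⟩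
    exact ⟨c.2 - c.1, by omega, Prod.ext rfl (by simp; omega)⟩

theorem mem_boxes {c : ℕ × ℕ} : c ∈ lam.boxes ↔ c ∈ lam.shiftedDiagram := by
  simp only [boxes, List.mem_flatMap, List.mem_reverse, List.mem_range, mem_rowBoxes]
  refine ⟨fun ⟨_, _, h, _⟩ => h, fun h => ⟨c.1, ?_, h, rfl⟩⟩
  have := h.1
  have := h.2
  exact lam.lt_length_of_part_ne_zero (by omega)

theorem nodup_boxes : lam.boxes.Nodup := by
  refine List.nodup_flatMap.2 ⟨fun p _ => List.nodup_range.map fun _ _ h => by simpa using h, ?_⟩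
  refine (List.nodup_reverse.2 List.nodup_range).imp fun hpq c hp hq => hpq ?_
  exact (mem_rowBoxes.1 hp).2.symm.trans (mem_rowBoxes.1 hq).2

theorem rowBoxes_eq_nil {p : ℕ} (h : lam.length ≤ p) : lam.rowBoxes p = [] := by
  rw [rowBoxes, not_not.1 (mt lam.lt_length_of_part_ne_zero h.not_gt), List.range_zero,
    List.map_nil]

theorem boxes_eq_flatMap {N : ℕ} (h : lam.length ≤ N) :
    lam.boxes = (List.range N).reverse.flatMap lam.rowBoxes := by
  induction N, h using Nat.le_induction with
  | base => rfl
  | succ N h ih => simp [List.range_succ, rowBoxes_eq_nil h, ih]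

theorem map_rowBoxes {β : Type*} (f : ℕ × ℕ → β) (p : ℕ) :
    (lam.rowBoxes p).map f = (List.range (lam.part p)).map fun q => f (p, p + q) :=
  List.map_map

theorem part_le_hookLength_iff {α : Type*} [LinearOrder α] {f : ℕ × ℕ → α} {p : ℕ} :
    lam.part p ≤ hookLength ((lam.rowBoxes p).map f) ↔
      IsHook ((List.range (lam.part p)).map fun q => f (p, p + q)) := by
  rw [map_rowBoxes, ← length_le_hookLength_iff, List.length_map, List.length_range]

theorem rowBoxes_append_isInfix (k : ℕ) :
    lam.rowBoxes (k + 1) ++ lam.rowBoxes k <:+: lam.boxes := by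
  rw [boxes_eq_flatMap (Nat.le_add_left lam.length (k + 2)), List.range_add, List.range_succ,
    List.range_succ]
  simp only [List.reverse_append, List.reverse_cons, List.reverse_nil, List.nil_append,
    List.flatMap_append, List.flatMap_cons, List.flatMap_nil, List.append_nil, ← List.append_assoc]
  rw [List.append_assoc _ (lam.rowBoxes (k + 1))]
  exact List.infix_append _ _ _

end StrictPartition

section Tableaux

variable {n : ℕ} {lam mu : StrictPartition} {A : Type*}

/-- The box of the skew diagram with the coordinates `c`, if there is one. -/
noncomputable def toSkewBox (lam mu : StrictPartition) :
    ℕ × ℕ → Option ↥(lam.shiftedDiagram \ mu.shiftedDiagram) :=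
  Function.partialInv Subtype.val

theorem toSkewBox_eq_some_iff {c : ℕ × ℕ} {b : ↥(lam.shiftedDiagram \ mu.shiftedDiagram)} :
    toSkewBox lam mu c = some b ↔ b.1 = c :=
  Subtype.val_injective.isPartialInv b c

/-- The entry of `T` in the box with the coordinates `c`, or `none` if this box is not in the skew
diagram. -/
noncomputable def SkewTableau.entryAt (T : SkewTableau lam mu A) (c : ℕ × ℕ) : Option A :=
  (toSkewBox lam mu c).map T

namespace SkewTableau

variable {T T' : SkewTableau lam mu A}

theorem entryAt_eq_some_iff {c : ℕ × ℕ} {a : A} :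
    entryAt T c = some a ↔ ∃ b, b.1 = c ∧ T b = a := by
  simp only [entryAt, Option.map_eq_some_iff, toSkewBox_eq_some_iff]

theorem entryAt_mk (p q : ℕ) : entryAt T (p, p + q) = entry T p q := by
  rw [entry]
  split_ifs with h
  · exact entryAt_eq_some_iff.2 ⟨_, rfl, rfl⟩
  · refine Option.eq_none_iff_forall_ne_some.2 fun a ha => h ?_
    obtain ⟨⟨_, hb⟩, rfl, -⟩ := entryAt_eq_some_iff.1 ha
    simpa [StrictPartition.mk_mem_shiftedDiagram, and_comm] using hb

theorem row_eq_filterMap (p : ℕ) : row T p = (lam.rowBoxes p).filterMap (entryAt T) := by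
  rw [row, StrictPartition.rowBoxes, List.filterMap_map]
  exact List.filterMap_congr fun q _ => (entryAt_mk p q).symm

theorem revWord_eq_filterMap : revWord T = lam.boxes.filterMap (entryAt T) := by
  rw [revWord, word, List.reverse_flatMap, StrictPartition.boxes, List.filterMap_flatMap]
  simp [Function.comp_def, row_eq_filterMap]

theorem revWord_injective : Function.Injective (revWord : SkewTableau lam mu A → List A) := by
  intro T T' h
  have hmap (T : SkewTableau lam mu A) :
      revWord T = (lam.boxes.filterMap (toSkewBox lam mu)).map T := by
    rw [revWord_eq_filterMap, List.map_filterMap]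
    rfl
  rw [hmap, hmap] at h
  refine funext fun b => List.map_inj_left.1 h b (List.mem_filterMap.2 ⟨b.1, ?_, ?_⟩)
  · exact StrictPartition.mem_boxes.2 b.2.1
  · exact toSkewBox_eq_some_iff.2 rfl

theorem entryAt_update_of_ne {b : ↥(lam.shiftedDiagram \ mu.shiftedDiagram)} {y : A} {c : ℕ × ℕ}
    (h : c ≠ b.1) : entryAt (Function.update T b y) c = entryAt T c :=
  Option.map_congr fun b' hb' => Function.update_of_ne
    (fun hb => h (by rw [← toSkewBox_eq_some_iff.1 hb', hb])) y T

theorem filterMap_entryAt_update {b : ↥(lam.shiftedDiagram \ mu.shiftedDiagram)} {y : A}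
    {X : List (ℕ × ℕ)} (h : b.1 ∉ X) :
    X.filterMap (entryAt (Function.update T b y)) = X.filterMap (entryAt T) :=
  List.filterMap_congr fun _ hc => entryAt_update_of_ne (ne_of_mem_of_not_mem hc h)

theorem exists_boxes_eq_of_revWord_eq {u v : List A} {x : A} (h : revWord T = u ++ x :: v) :
    ∃ X₁ b X₂, lam.boxes = X₁ ++ b.1 :: X₂ ∧ X₁.filterMap (entryAt T) = u ∧ T b = x ∧
      X₂.filterMap (entryAt T) = v := by
  rw [revWord_eq_filterMap] at h
  obtain ⟨X, Z, hX, rfl, hZ⟩ := List.filterMap_eq_append_iff.1 h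
  obtain ⟨Y, c, X₂, rfl, hY, hc, rfl⟩ := List.filterMap_eq_cons_iff.1 hZ
  obtain ⟨b, rfl, hb⟩ := entryAt_eq_some_iff.1 hc
  refine ⟨X ++ Y, b, X₂, by rw [hX, List.append_assoc], ?_, hb, rfl⟩
  rw [List.filterMap_append, List.filterMap_eq_nil_iff.2 hY, List.append_nil]

theorem revWord_update {X₁ X₂ : List (ℕ × ℕ)} {b : ↥(lam.shiftedDiagram \ mu.shiftedDiagram)}
    (h : lam.boxes = X₁ ++ b.1 :: X₂) (y : A) : revWord (Function.update T b y) =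
      X₁.filterMap (entryAt T) ++ y :: X₂.filterMap (entryAt T) := by
  have hb := (List.nodup_cons.1 (List.nodup_middle.1 (h ▸ StrictPartition.nodup_boxes))).1
  rw [List.mem_append, not_or] at hb
  rw [revWord_eq_filterMap, h, List.filterMap_append, filterMap_entryAt_update hb.1,
    List.filterMap_cons_some (entryAt_eq_some_iff.2 ⟨b, rfl, Function.update_self b y T⟩),
    filterMap_entryAt_update hb.2]

end SkewTableau
end Tableaux

/-! ### Decomposition tableaux in terms of hook lengths -/

section Padding

variable {n : ℕ} {lam mu : StrictPartition} {T T' : SkewTableau lam mu (Letter n)}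

namespace SkewTableau

/-- The tableau `T` with the removed boxes filled by entries larger than all letters. The filling is
constant in each row and decreases down the columns, so it is compatible with (S1) and (S2). -/
noncomputable def padded (T : SkewTableau lam mu (Letter n)) (c : ℕ × ℕ) : ℕ :=
  (entryAt T c).elim (n + 1 + mu.part c.1) Subtype.val

theorem one_le_padded (c : ℕ × ℕ) : 1 ≤ padded T c := by
  rw [padded]
  rcases entryAt T c with _ | a
  · exact Nat.le_add_left 1 n |>.trans (Nat.le_add_right _ _)
  · exact a.2.1

theorem padded_le (c : ℕ × ℕ) : padded T c ≤ n + 1 + mu.part c.1 := by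
  rw [padded]
  rcases entryAt T c with _ | a
  · exact le_rfl
  · exact a.2.2.trans (by omega)

theorem padded_of_mem_entry {p q : ℕ} {a : Letter n} (ha : a ∈ entry T p q) :
    padded T (p, p + q) = a.1 := by
  rw [padded, entryAt_mk, Option.mem_def.1 ha]
  rfl

theorem exists_mem_entry_of_padded_le {p q : ℕ} (h : padded T (p, p + q) ≤ n) :
    ∃ a ∈ entry T p q, a.1 = padded T (p, p + q) := by
  rw [padded, entryAt_mk] at *
  rcases hT : entry T p q with _ | a
  · simp only [hT, Option.elim_none] at h
    omega
  · exact ⟨a, rfl, rfl⟩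

theorem padded_of_lt {p q : ℕ} (h : q < mu.part p) :
    padded T (p, p + q) = n + 1 + mu.part p := by
  rw [padded, entryAt_mk, entry, dif_neg fun h' => h'.1.not_gt h, Option.elim_none]

theorem padded_le_iff {p q : ℕ} (hq : q < lam.part p) :
    padded T (p, p + q) ≤ n ↔ mu.part p ≤ q := by
  refine ⟨fun h => not_lt.1 fun hlt => ?_, fun h => ?_⟩
  · rw [padded_of_lt hlt] at h
    omega
  · rw [padded, entryAt_mk, entry, dif_pos ⟨h, hq⟩]
    exact (T _).2.2

theorem filter_map_padded (X : List (ℕ × ℕ)) :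
    (X.map (padded T)).filter (· ≤ n) = (X.filterMap (entryAt T)).map Subtype.val := by
  induction X with
  | nil => rfl
  | cons c X ih =>
    rw [List.map_cons, List.filter_cons, ih, padded, List.filterMap_cons]
    rcases entryAt T c with _ | a
    · simp [show ¬ n + 1 + mu.part c.1 ≤ n by omega]
    · simp [a.2.2]

theorem isHook_padded_row_iff (p : ℕ) :
    IsHook ((List.range (lam.part p)).map fun q => padded T (p, p + q)) ↔ IsHook (row T p) := by
  constructor
  · intro h
    have hval := h.sublist (List.filter_sublist (p := (· ≤ n)))
    rw [← StrictPartition.map_rowBoxes, filter_map_padded, ← row_eq_filterMap] at hval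
    exact List.triplewise_map.1 hval
  · rw [isHook_map_range_iff]
    intro h x y z hxy hyz hz hlt
    have hx : mu.part p ≤ x := by
      by_contra! hx
      exact hlt.not_ge (padded_of_lt (T := T) hx ▸ padded_le (p, p + y))
    have hentry (q : ℕ) (hxq : x ≤ q) (hqz : q ≤ z) :
        ∃ a ∈ entry T p q, a.1 = padded T (p, p + q) :=
      exists_mem_entry_of_padded_le ((padded_le_iff (hqz.trans_lt hz)).2 (hx.trans hxq))
    obtain ⟨a, ha, hxa⟩ := hentry x le_rfl (hxy.trans hyz).le
    obtain ⟨b, hb, hyb⟩ := hentry y hxy.le hyz.le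
    obtain ⟨c, hc, hzc⟩ := hentry z (hxy.trans hyz).le le_rfl
    have hsub : [a, b, c].Sublist (row T p) := by
      have hxyz : [x, y, z].Sublist (List.range (lam.part p)) :=
        sublist_range_of_pairwise_lt (by simp; omega) (by simp; omega)
      simpa [row, Option.mem_def.1 ha, Option.mem_def.1 hb, Option.mem_def.1 hc] using
        hxyz.filterMap (entry T p)
    rw [← hxa, ← hyb] at hlt
    rw [← hyb, ← hzc]
    exact h.lt_of_sublist hsub hlt

theorem rowsCompatible_padded_iff (k : ℕ) :
    RowsCompatible (fun q => padded T (k, k + q)) (fun q => padded T (k + 1, k + 1 + q))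
        (lam.part (k + 1)) ↔
      (∀ i j, i ≤ j → j < lam.part (k + 1) →
        ∀ a ∈ entry T k i, ∀ b ∈ entry T (k + 1) j, a ≤ b →
          i ≠ 0 ∧ ∃ c ∈ entry T (k + 1) (i - 1), c < b) ∧
      ∀ i j, i ≤ j → j < lam.part (k + 1) →
        ∀ a ∈ entry T k i, ∀ b ∈ entry T (k + 1) j, a > b →
          ∃ c ∈ entry T k (j + 1), a ≥ c := by
  have hlam := lam.part_succ_le k
  unfold RowsCompatible
  dsimp only
  refine and_congr (forall₄_congr fun i j hij hj => ⟨fun h a ha b hb hab => ?_, fun h hle => ?_⟩)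
    (forall₄_congr fun i j hij hj => ⟨fun h a ha b hb hab => ?_, fun h hlt => ?_⟩)
  · rw [padded_of_mem_entry ha, padded_of_mem_entry hb] at h
    obtain ⟨hi, hlt⟩ := h hab
    obtain ⟨c, hc, hpc⟩ := exists_mem_entry_of_padded_le (hlt.le.trans b.2.2)
    exact ⟨hi, c, hc, hpc.trans_lt hlt⟩
  · have hbn : padded T (k + 1, k + 1 + j) ≤ n := by
      rw [padded_le_iff hj]
      by_contra! hjmu
      have := mu.part_succ_lt (k := k) (by omega)
      rw [padded_of_lt hjmu, padded_of_lt ((hij.trans_lt hjmu).trans this)] at hle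
      omega
    obtain ⟨b, hb, hpb⟩ := exists_mem_entry_of_padded_le hbn
    obtain ⟨a, ha, hpa⟩ := exists_mem_entry_of_padded_le (hle.trans hbn)
    obtain ⟨hi, c, hc, hcb⟩ := h a ha b hb (show a.1 ≤ b.1 by rwa [hpa, hpb])
    rw [padded_of_mem_entry hc, ← hpb]
    exact ⟨hi, hcb⟩
  · rw [padded_of_mem_entry ha, padded_of_mem_entry hb] at h
    obtain ⟨c, hc, hpc⟩ := exists_mem_entry_of_padded_le ((h hab).trans a.2.2)
    exact ⟨c, hc, hpc.trans_le (h hab)⟩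
  · by_cases han : padded T (k, k + i) ≤ n
    · obtain ⟨a, ha, hpa⟩ := exists_mem_entry_of_padded_le han
      obtain ⟨b, hb, hpb⟩ := exists_mem_entry_of_padded_le (hlt.le.trans han)
      obtain ⟨c, hc, hca⟩ := h a ha b hb (show b.1 < a.1 by rwa [hpa, hpb])
      rw [padded_of_mem_entry hc, ← hpa]
      exact hca
    · rw [padded_le_iff (by omega), not_le] at han
      exact padded_of_lt (T := T) han ▸ padded_le (k, k + (j + 1))

theorem isHookWord_row_iff (k : ℕ) :
    (row T k ≠ [] → IsHookWord (row T k)) ↔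
      lam.part k ≤ hookLength ((lam.rowBoxes k).map (padded T)) := by
  rw [StrictPartition.part_le_hookLength_iff, isHook_padded_row_iff, isHookWord_iff]
  refine ⟨fun h => ?_, fun h hne => ⟨hne, h⟩⟩
  by_cases hnil : row T k = []
  · exact hnil ▸ .nil
  · exact (h hnil).2

theorem rowsCompatible_padded_iff_hookLength
    (h : ∀ k, lam.part k ≤ hookLength ((lam.rowBoxes k).map (padded T))) (k : ℕ) :
    RowsCompatible (fun q => padded T (k, k + q)) (fun q => padded T (k + 1, k + 1 + q))
        (lam.part (k + 1)) ↔
      hookLength ((lam.rowBoxes (k + 1) ++ lam.rowBoxes k).map (padded T)) ≤ lam.part k := by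
  simp only [StrictPartition.part_le_hookLength_iff] at h
  rw [List.map_append, StrictPartition.map_rowBoxes, StrictPartition.map_rowBoxes]
  rcases (lam.part_succ_le k).eq_or_lt with heq | hlt
  · have h0 := lam.eq_zero_of_eq k heq.symm
    simp [RowsCompatible, heq, h0, hookLength_nil]
  · exact rowsCompatible_iff_hookLength_le hlt (h k) (h (k + 1))

theorem isSkewSSDT_iff_hookLength : IsSkewSSDT T ↔ ∀ k,
    lam.part k ≤ hookLength ((lam.rowBoxes k).map (padded T)) ∧
      hookLength ((lam.rowBoxes (k + 1) ++ lam.rowBoxes k).map (padded T)) ≤ lam.part k := by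
  rw [forall_and]
  constructor
  · intro h
    have hook := fun k => (isHookWord_row_iff k).1 (h.hook k)
    exact ⟨hook, fun k => (rowsCompatible_padded_iff_hookLength hook k).1
      ((rowsCompatible_padded_iff k).2 ⟨h.cond_one k, h.cond_two k⟩)⟩
  · rintro ⟨hook, h⟩
    have compat := fun k => (rowsCompatible_padded_iff k).1
      ((rowsCompatible_padded_iff_hookLength hook k).2 (h k))
    exact ⟨fun k => (isHookWord_row_iff k).2 (hook k), fun k => (compat k).1, fun k => (compat k).2⟩

theorem padded_update_of_ne {b : ↥(lam.shiftedDiagram \ mu.shiftedDiagram)} {y : Letter n}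
    {c : ℕ × ℕ} (h : c ≠ b.1) : padded (Function.update T b y) c = padded T c := by
  rw [padded, padded, entryAt_update_of_ne h]

theorem padded_coe (b : ↥(lam.shiftedDiagram \ mu.shiftedDiagram)) : padded T b.1 = (T b).1 := by
  rw [padded, entryAt_eq_some_iff.2 ⟨b, rfl, rfl⟩, Option.elim_some]

theorem isSkewSSDT_iff_of_loweringStep {i : QIndex n}
    (h : LoweringStep i (revWord T) (revWord T')) : IsSkewSSDT T ↔ IsSkewSSDT T' := by
  obtain ⟨A, x, y, B, hA, hB, ⟨hx, hy⟩, hAB⟩ := h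
  obtain ⟨X₁, b, X₂, hX, rfl, rfl, rfl⟩ := exists_boxes_eq_of_revWord_eq hA
  obtain rfl : T' = Function.update T b y := revWord_injective (hB.trans (revWord_update hX y).symm)
  have hex : Exchangeable (padded T b.1) (X₁.map (padded T)) (X₂.map (padded T)) := by
    rw [padded_coe, hx]
    refine .of_filter (hy ▸ y.2.2) ?_
    rw [filter_map_padded, filter_map_padded]
    exact hAB.exchangeable
  have heq : ∀ M, M <:+: lam.boxes →
      hookLength (M.map (padded T)) = hookLength (M.map (padded (Function.update T b y))) :=
    fun M hM => hex.hookLength_map one_le_padded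
      (by rw [padded_coe, padded_coe, Function.update_self, hx, hy])
      (fun c hc => (padded_update_of_ne hc).symm) (hX ▸ StrictPartition.nodup_boxes) (hX ▸ hM)
  simp only [isSkewSSDT_iff_hookLength, heq _ (StrictPartition.rowBoxes_append_isInfix _),
    heq _ ((List.suffix_append _ _).isInfix.trans (StrictPartition.rowBoxes_append_isInfix _))]

end SkewTableau
end Padding

/-! ### Closure under the operators -/

section Closure

variable {n : ℕ} {lam mu : StrictPartition}

theorem append_cons_mem_range_revWord {A : Type*} {u v : List A} {x : A} (y : A)
    (h : u ++ x :: v ∈ Set.range (SkewTableau.revWord : SkewTableau lam mu A → List A)) :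
    u ++ y :: v ∈ Set.range (SkewTableau.revWord : SkewTableau lam mu A → List A) := by
  obtain ⟨T, hT⟩ := h
  obtain ⟨X₁, b, X₂, hX, rfl, rfl, rfl⟩ := SkewTableau.exists_boxes_eq_of_revWord_eq hT
  exact ⟨Function.update T b y, SkewTableau.revWord_update hX y⟩

theorem LoweringStep.mem_range_revWord_iff {i : QIndex n} {w w' : List (Letter n)}
    (h : LoweringStep i w w') :
    w ∈ Set.range (SkewTableau.revWord : SkewTableau lam mu (Letter n) → List (Letter n)) ↔
      w' ∈ Set.range (SkewTableau.revWord : SkewTableau lam mu (Letter n) → List (Letter n)) := by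
  obtain ⟨u, x, y, v, rfl, rfl, -⟩ := h
  exact ⟨append_cons_mem_range_revWord y, append_cons_mem_range_revWord x⟩

theorem LoweringStep.mem_image_skewB_iff {i : QIndex n} {w w' : List (Letter n)}
    (h : LoweringStep i w w') :
    w ∈ SkewTableau.revWord '' skewB n lam mu ↔ w' ∈ SkewTableau.revWord '' skewB n lam mu := by
  constructor
  · rintro ⟨T, hT, rfl⟩
    obtain ⟨T', rfl⟩ := h.mem_range_revWord_iff.1 ⟨T, rfl⟩
    exact ⟨T', (SkewTableau.isSkewSSDT_iff_of_loweringStep h).1 hT, rfl⟩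
  · rintro ⟨T', hT', rfl⟩
    obtain ⟨T, rfl⟩ := h.mem_range_revWord_iff.2 ⟨T', rfl⟩
    exact ⟨T, (SkewTableau.isSkewSSDT_iff_of_loweringStep h).2 hT', rfl⟩

end Closure

end SkewSSDT

theorem proposition6p2_general (n : ℕ) (lam mu : StrictPartition) :
    Set.InjOn SkewTableau.revWord (skewB n lam mu) ∧
    (∀ (i : QIndex n), ∀ w ∈ SkewTableau.revWord '' skewB n lam mu,
      (∀ w', (wordCrystal n).e i w = some w' → w' ∈ SkewTableau.revWord '' skewB n lam mu) ∧
      (∀ w', (wordCrystal n).f i w = some w' → w' ∈ SkewTableau.revWord '' skewB n lam mu)) ∧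
    ∃ C : CrystalData n (skewB n lam mu), C.IsQCrystal ∧
      (∀ T, C.wt T = (wordCrystal n).wt (SkewTableau.revWord T.1)) ∧
      (∀ i T, C.ε i T = (wordCrystal n).ε i (SkewTableau.revWord T.1)) ∧
      (∀ i T, C.φ i T = (wordCrystal n).φ i (SkewTableau.revWord T.1)) ∧
      (∀ i T, (C.e i T).map (fun T' => SkewTableau.revWord T'.1) =
        (wordCrystal n).e i (SkewTableau.revWord T.1)) ∧
      (∀ i T, (C.f i T).map (fun T' => SkewTableau.revWord T'.1) =
        (wordCrystal n).f i (SkewTableau.revWord T.1)) := by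
  let g (T : skewB n lam mu) : List (Letter n) := SkewTableau.revWord T.1
  have g_injective : Function.Injective g :=
    SkewTableau.revWord_injective.comp Subtype.val_injective
  have range_g : Set.range g = SkewTableau.revWord '' skewB n lam mu :=
    (Set.image_eq_range _ _).symm
  have closed (i : QIndex n) (w) (hw : w ∈ Set.range g) :
      (∀ w', (wordCrystal n).e i w = some w' → w' ∈ Set.range g) ∧
        ∀ w', (wordCrystal n).f i w = some w' → w' ∈ Set.range g := by
    rw [range_g] at hw ⊢
    exact ⟨fun w' h => (wordCrystal_e_eq_some_iff.1 h).mem_image_skewB_iff.2 hw,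
      fun w' h => (wordCrystal_f_eq_some_iff.1 h).mem_image_skewB_iff.1 hw⟩
  have morphism : ((wordCrystal n).comap g).IsStrictMorphism (wordCrystal n) g :=
    CrystalData.comap_isStrictMorphism g_injective
      (fun i T => (closed i (g T) ⟨T, rfl⟩).1) (fun i T => (closed i (g T) ⟨T, rfl⟩).2)
  exact ⟨SkewTableau.revWord_injective.injOn, range_g ▸ closed, (wordCrystal n).comap g,
    morphism.isQCrystal g_injective wordCrystal_isQCrystal,
    morphism.wt, morphism.ε, morphism.φ, morphism.e, morphism.f⟩

theorem proposition6p2 (n : ℕ) (hn : 2 ≤ n) (lam mu : StrictPartition)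
    (hsub : mu.shiftedDiagram ⊆ lam.shiftedDiagram) (hlen : lam.length ≤ n) :
    -- the reversed reading word is injective on `B_n(lam / mu)`
    Set.InjOn SkewTableau.revWord (skewB n lam mu) ∧
    -- its image together with `0` is invariant under all `e_i`, `f_i` with `i ∈ I`
    (∀ (i : QIndex n), ∀ w ∈ SkewTableau.revWord '' skewB n lam mu,
      (∀ w', (wordCrystal n).e i w = some w' → w' ∈ SkewTableau.revWord '' skewB n lam mu) ∧
      (∀ w', (wordCrystal n).f i w = some w' → w' ∈ SkewTableau.revWord '' skewB n lam mu)) ∧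
    -- `B_n(lam / mu)` is a `q(n)`-crystal with the maps induced from those on words
    ∃ C : CrystalData n (skewB n lam mu), C.IsQCrystal ∧
      (∀ T, C.wt T = (wordCrystal n).wt (SkewTableau.revWord T.1)) ∧
      (∀ i T, C.ε i T = (wordCrystal n).ε i (SkewTableau.revWord T.1)) ∧
      (∀ i T, C.φ i T = (wordCrystal n).φ i (SkewTableau.revWord T.1)) ∧
      (∀ i T, (C.e i T).map (fun T' => SkewTableau.revWord T'.1) =
        (wordCrystal n).e i (SkewTableau.revWord T.1)) ∧
      (∀ i T, (C.f i T).map (fun T' => SkewTableau.revWord T'.1) =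
        (wordCrystal n).f i (SkewTableau.revWord T.1)) :=
  proposition6p2_general n lam mu
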